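/- Consider a residual network with blocks $l=1,\dots,L$: $z^1=x$, $\bar z^l=\xi_2^l\odot h^l(z^l)$ (a constant entry $1$ is appended to $\bar z^l$, so that biases are the last columns of $W_1^l,W_3^l$), $$z^{l+1}=\xi_B^l\,W_2^l\bigl(\xi_1^l\odot a^l(W_1^l\bar z^l)\bigr)+W_3^l\bar z^l,\qquad \hat y=h^{L+1}(z^{L+1}),$$ with element-wise activation functions $a^l,h^l$ that are $C^1$ with bounded derivative and vanish at $0$, and with independent Bernoulli gates $\Xi=(\xi_B^l,\xi_{1i}^l,\xi_{2k}^l)$ with parameters $\Theta=(\theta_B^l,\theta_{1i}^l,\theta_{2k}^l)\in[0,1]$. Given a finite data set $(x_n,y_n)_{n\le N}$ and a likelihood $p(y_n\mid\hat y)$ that is positive and $C^1$ in $\hat y$, let $C(W,\Theta)=\mathbb E_\Xi\bigl[-\tfrac1N\sum_n\log p(y_n\mid x_n,W,\Xi)\bigr]$. Fix a block $l$ and one of its hidden units $i$; drop $l$. Let $C^{b}$ be the expectation given $\xi_B=b$, and $C^1_{1i,c}$ the one given $\xi_B=1,\ \xi_{1i}=c$. Let $w_{1i}$ (row $i$ of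 $W_1$) and $w_{2i}$ (column $i$ of $W_2$) be the fan-in and fan-out weights of the unit. Consider $$\begin{aligned}\dot w_{1i}&=-\theta_B\theta_{1i}\nabla_{w_{1i}}C^1_{1i,1}-\lambda w_{1i},\qquad \dot w_{2i}=-\theta_B\theta_{1i}\nabla_{w_{2i}}C^1_{1i,1}-\lambda w_{2i},\\ \dot\theta_{1i}&=-\theta_B\bigl[C^1_{1i,1}-C^1_{1i,0}+R\bigr]-h_{1i},\qquad \dot\theta_B=-\bigl[C^1-C^0+\|\theta_1\|_1R\bigr]-\nu\alpha-h_B,\end{aligned}$$ where $\lambda>0$, $\nu>0$, $\alpha\ge0$, $\beta\in[0,1]$, the terms $h_{1i},h_B$ project $\theta_{1i},\theta_B$ to $[0,1]$ (if $\dot\theta=-g-h$, then $h=-[g]_+$ at $\theta=0$, $h=[g]_-$ at $\theta=1$, and $h=0$ in between), and $$R=\nu\Bigl(\tfrac{\beta}{F}\bigl(f_1\|\theta_2^l\|_1+f_a+f_2\|\theta_2^{l+1}\|_1\bigr)+\tfrac{1-\beta}{P}\bigl(p_1\|\theta_2^l\|_1+1+p_2\|\theta_2^{l+1}\|_1\bigr)\Bigr)$$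 with block constants $f_1,f_2,f_a,p_1,p_2$, totals $F,P>0$, and $\theta_2^{L+1}=(1,\dots,1)$. All other weights and Bernoulli parameters of the network are given functions of time $t\ge0$, the weights bounded entrywise by a constant $M$, the Bernoulli parameters in $[0,1]$. Assume that the right-hand side without the projection terms is piecewise continuous in time and, for $\theta_{1i},\theta_B\in[0,1]$, locally Lipschitz in $(w_{1i},w_{2i},\theta_{1i},\theta_B)$ uniformly in time, and that $R\ge R_m$ for all $t\ge 0$, with a constant $R_m>0$. (1) There are constants $\eta,\kappa>0$, depending only on the network model, the data, the unit and $M$, such that for all weights bounded entrywise by $M$ and all $\Theta\in[0,1]$: $$|w_{ji}^\top\nabla_{w_{ji}}C^1_{1i,1}|\le\eta\|w_{ji}\|\ (j=1,2),\qquad |C^1_{1i,1}-C^1_{1i,0}|\le\kappa(\|w_{1i}\|+\|w_{2i}\|).$$ (2) For any such $\eta,\kappa$ put $\Lambda_U=\tfrac12(\|w_{1i}\|^2+\|w_{2i}\|^2+\theta_{1i}^2)$ and $$\mathcal D_U=\Bigl\{\theta_{1i},\theta_B\in[0,1],\ \Lambda_U\le\tfrac12\tfrac{R_m^2}{16(\eta+\kappa)^2}\Bigr\},\qquad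 E_U=\{(w_{1i},w_{2i},\theta_{1i},\theta_B)\in\mathcal D_U: w_{1i}=0,\ w_{2i}=0,\ \theta_{1i}\theta_B=0\}.$$ Then $E_U$ is attractive from $\mathcal D_U$: for every initial time $t_0\ge0$, every solution on $[t_0,\infty)$ that starts in $\mathcal D_U$ and along which the weights of the unit are bounded by $M$ too stays in $\mathcal D_U$, does not increase $\Lambda_U$, and its distance to $E_U$ tends to $0$. If $R_m/(4(\eta+\kappa))<M$ (the weights in $\mathcal D_U$ lie in the range where $\eta,\kappa$ are valid), that boundedness of the unit's weights need not be assumed, and $\mathcal D_U$ belongs to the region of attraction of $E_U$: for every $t_0\ge 0$, from each point of $\mathcal D_U$ a solution on $[t_0,\infty)$ exists, and every solution on $[t_0,\infty)$ from it approaches $E_U$. -/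

import Mathlib

open Set Filter Topology MeasureTheory

noncomputable section

/-!
### The stochastic residual network

A network has `L` blocks. The features entering block `l` have dimension `d l.castSucc`, those
leaving it have dimension `d l.succ`, and the nonlinear path of block `l` has `K l` hidden units.
-/

/-- The fixed part of the model: the element-wise activation functions `a l` (hidden units of
block `l`) and `h l` (features; `h (Fin.last L)` is applied at the network output), and the
likelihood `p ŷ y` which the statistical model assigns to the target `y` when the network output
is `ŷ`. -/
structure NetModel (L : ℕ) (d : Fin (L + 1) → ℕ) where
  a : Fin L → ℝ → ℝ
  h : Fin (L + 1) → ℝ → ℝ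
  p : (Fin (d (Fin.last L)) → ℝ) → (Fin (d (Fin.last L)) → ℝ) → ℝ

/-- All weights of the network. The bias vectors are the last columns of `W₁` and `W₃`. -/
structure Weights (L : ℕ) (d : Fin (L + 1) → ℕ) (K : Fin L → ℕ) where
  W₁ : ∀ l : Fin L, Matrix (Fin (K l)) (Fin (d l.castSucc + 1)) ℝ
  W₂ : ∀ l : Fin L, Matrix (Fin (d l.succ)) (Fin (K l)) ℝ
  W₃ : ∀ l : Fin L, Matrix (Fin (d l.succ)) (Fin (d l.castSucc + 1)) ℝ

/-- A finite data set of `N` input/target pairs. -/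
structure DataSet (L : ℕ) (d : Fin (L + 1) → ℕ) (N : ℕ) where
  x : Fin N → Fin (d 0) → ℝ
  y : Fin N → Fin (d (Fin.last L)) → ℝ

/-- The index set of the Bernoulli variables `ξ_B^l` (scalar), `ξ_1^l` (one per hidden unit) and
`ξ_2^l` (one per feature), and so of their parameters `θ_B^l`, `θ_{1i}^l`, `θ_{2i}^l`. -/
abbrev Gate (L : ℕ) (d : Fin (L + 1) → ℕ) (K : Fin L → ℕ) : Type :=
  Fin L ⊕ (Σ l : Fin L, Fin (K l)) ⊕ (Σ l : Fin L, Fin (d l.castSucc))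

section

variable {L N : ℕ} {d : Fin (L + 1) → ℕ} {K : Fin L → ℕ}

/-- The gate `B` of block `l`. -/
def gateB (l : Fin L) : Gate L d K := Sum.inl l

/-- The gate of the hidden unit `i` of block `l`. -/
def gate1 (l : Fin L) (i : Fin (K l)) : Gate L d K := Sum.inr (Sum.inl ⟨l, i⟩)

/-- The gate of the feature `k` entering block `l`. -/
def gate2 (l : Fin L) (k : Fin (d l.castSucc)) : Gate L d K := Sum.inr (Sum.inr ⟨l, k⟩)

/-- The real number `0` or `1` of a gate. -/
def bit (b : Bool) : ℝ := if b then 1 else 0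

/-- The gated features `z̄ = ξ₂ ⊙ h(z)` entering block `l`, with the constant `1` appended. -/
def gatedFeatures (net : NetModel L d) (Ξ : Gate L d K → Bool) (l : Fin L)
    (z : Fin (d l.castSucc) → ℝ) : Fin (d l.castSucc + 1) → ℝ :=
  Fin.snoc (fun k => bit (Ξ (gate2 l k)) * net.h l.castSucc (z k)) 1

/-- One block of the network:
`z ↦ ξ_B W₂ (ξ₁ ⊙ a(W₁ z̄)) + W₃ z̄`. -/
def block (net : NetModel L d) (W : Weights L d K) (Ξ : Gate L d K → Bool) (l : Fin L)
    (z : Fin (d l.castSucc) → ℝ) : Fin (d l.succ) → ℝ :=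
  bit (Ξ (gateB l)) •
      (W.W₂ l).mulVec (fun j => bit (Ξ (gate1 l j)) *
        net.a l ((W.W₁ l).mulVec (gatedFeatures net Ξ l z) j))
    + (W.W₃ l).mulVec (gatedFeatures net Ξ l z)

/-- The features `z^l`, for all `l`, produced by the network input `x`. -/
def features (net : NetModel L d) (W : Weights L d K) (Ξ : Gate L d K → Bool)
    (x : Fin (d 0) → ℝ) : ∀ l : Fin (L + 1), Fin (d l) → ℝ :=
  Fin.induction (motive := fun l => Fin (d l) → ℝ) x (fun l z => block net W Ξ l z)

/-- The network output `ŷ`. -/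
def output (net : NetModel L d) (W : Weights L d K) (Ξ : Gate L d K → Bool)
    (x : Fin (d 0) → ℝ) : Fin (d (Fin.last L)) → ℝ :=
  fun k => net.h (Fin.last L) (features net W Ξ x (Fin.last L) k)

/-- The negative log-likelihood per sample, `-(1/N) log p(Y | X, W, Ξ)`. -/
def sampleCost (net : NetModel L d) (data : DataSet L d N) (W : Weights L d K)
    (Ξ : Gate L d K → Bool) : ℝ :=
  (1 / (N : ℝ)) * ∑ n, -Real.log (net.p (output net W Ξ (data.x n)) (data.y n))

/-- The probability of the gate values `Ξ` under independent Bernoulli variables with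
parameters `Θ`. -/
def bernoulliWeight (Θ : Gate L d K → ℝ) (Ξ : Gate L d K → Bool) : ℝ :=
  ∏ g, if Ξ g then Θ g else 1 - Θ g

/-- The expected cost `C(W, Θ)`. -/
def cost (net : NetModel L d) (data : DataSet L d N) (W : Weights L d K)
    (Θ : Gate L d K → ℝ) : ℝ :=
  ∑ Ξ : Gate L d K → Bool, bernoulliWeight Θ Ξ * sampleCost net data W Ξ

/-- `C^b`: the expected cost given `ξ_B^l = b`. As the gates are independent, conditioning on the
value of a gate means giving it the Bernoulli parameter `0` or `1`. -/
def costB (net : NetModel L d) (data : DataSet L d N) (l : Fin L) (b : Bool)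
    (W : Weights L d K) (Θ : Gate L d K → ℝ) : ℝ :=
  cost net data W (Function.update Θ (gateB l) (bit b))

/-- `C_{1i,c}^1`: the expected cost given `ξ_B^l = 1` and `ξ_{1i}^l = c`. -/
def costUnit (net : NetModel L d) (data : DataSet L d N) (l : Fin L) (i : Fin (K l)) (c : Bool)
    (W : Weights L d K) (Θ : Gate L d K → ℝ) : ℝ :=
  cost net data W (Function.update (Function.update Θ (gateB l) 1) (gate1 l i) (bit c))

/-!
### Fan-in and fan-out weights of one unit
-/

/-- Fan-in weight vectors (bias included) of a unit of block `l`. -/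
abbrev FanIn (d : Fin (L + 1) → ℕ) (l : Fin L) : Type :=
  EuclideanSpace ℝ (Fin (d l.castSucc + 1))

/-- Fan-out weight vectors of a unit of block `l`. -/
abbrev FanOut (d : Fin (L + 1) → ℕ) (l : Fin L) : Type :=
  EuclideanSpace ℝ (Fin (d l.succ))

/-- The weights `W`, with the fan-in and fan-out weights of unit `i` of block `l` replaced by
`w₁` and `w₂`. -/
def Weights.setUnit (W : Weights L d K) (l : Fin L) (i : Fin (K l))
    (w₁ : FanIn d l) (w₂ : FanOut d l) : Weights L d K where
  W₁ := Function.update W.W₁ l ((W.W₁ l).updateRow i w₁)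
  W₂ := Function.update W.W₂ l ((W.W₂ l).updateCol i w₂)
  W₃ := W.W₃

/-- All entries of all weight matrices are bounded by `M`. -/
def Weights.BoundedBy (W : Weights L d K) (M : ℝ) : Prop :=
  (∀ l j k, |W.W₁ l j k| ≤ M) ∧ (∀ l j k, |W.W₂ l j k| ≤ M) ∧ (∀ l j k, |W.W₃ l j k| ≤ M)

/-- All Bernoulli parameters lie in `[0, 1]`. -/
def InCube (Θ : Gate L d K → ℝ) : Prop := ∀ g, Θ g ∈ Icc (0 : ℝ) 1

/-- `∇_{w_{1i}} C_{1i,1}^1` at the weights `W` with unit weights `w₁`, `w₂`. -/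
def gradIn (net : NetModel L d) (data : DataSet L d N) (l : Fin L) (i : Fin (K l))
    (W : Weights L d K) (Θ : Gate L d K → ℝ) (w₁ : FanIn d l) (w₂ : FanOut d l) : FanIn d l :=
  gradient (fun w : FanIn d l => costUnit net data l i true (W.setUnit l i w w₂) Θ) w₁

/-- `∇_{w_{2i}} C_{1i,1}^1` at the weights `W` with unit weights `w₁`, `w₂`. -/
def gradOut (net : NetModel L d) (data : DataSet L d N) (l : Fin L) (i : Fin (K l))
    (W : Weights L d K) (Θ : Gate L d K → ℝ) (w₁ : FanIn d l) (w₂ : FanOut d l) : FanOut d l :=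
  gradient (fun w : FanOut d l => costUnit net data l i true (W.setUnit l i w₁ w) Θ) w₂

/-- The constants `η` and `κ` control the gradients of `C_{1i,1}^1` and the difference
`C_{1i,1}^1 - C_{1i,0}^1`, uniformly over all weights bounded by `M` and all Bernoulli
parameters. -/
def IsBoundPair (net : NetModel L d) (data : DataSet L d N) (l : Fin L) (i : Fin (K l))
    (M η κ : ℝ) : Prop :=
  0 < η ∧ 0 < κ ∧
  ∀ (W : Weights L d K) (Θ : Gate L d K → ℝ) (w₁ : FanIn d l) (w₂ : FanOut d l),
    (W.setUnit l i w₁ w₂).BoundedBy M → InCube Θ →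
      |inner ℝ w₁ (gradIn net data l i W Θ w₁ w₂)| ≤ η * ‖w₁‖ ∧
      |inner ℝ w₂ (gradOut net data l i W Θ w₁ w₂)| ≤ η * ‖w₂‖ ∧
      |costUnit net data l i true (W.setUnit l i w₁ w₂) Θ
          - costUnit net data l i false (W.setUnit l i w₁ w₂) Θ| ≤ κ * (‖w₁‖ + ‖w₂‖)

/-!
### The projected dynamical system of one unit
-/

/-- Hyperparameters: weight decay `lam`, complexity weight `ν`, layer penalty `α`, trade-off `β`,
the FLOPS constants `f₁ f₂ fa` and parameter-count constants `p₁ p₂` of the block, and the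
normalizing totals `F` and `P`. -/
structure Hyper where
  lam : ℝ
  ν : ℝ
  α : ℝ
  β : ℝ
  f₁ : ℝ
  f₂ : ℝ
  fa : ℝ
  p₁ : ℝ
  p₂ : ℝ
  F : ℝ
  P : ℝ

/-- `‖θ_1^l‖₁`. -/
def norm1 (Θ : Gate L d K → ℝ) (l : Fin L) : ℝ := ∑ k, |Θ (gate1 l k)|

/-- `‖θ_2^l‖₁`, where for the output features, which are not gated, `θ_2^{L+1} = (1, …, 1)`. -/
def norm2 (Θ : Gate L d K → ℝ) (l : Fin (L + 1)) : ℝ :=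
  Fin.lastCases (motive := fun _ => ℝ) (d (Fin.last L) : ℝ)
    (fun j : Fin L => ∑ k, |Θ (gate2 j k)|) l

/-- The complexity regularization `R = ν ∂²J_{FP} / ∂θ_B ∂θ_{1i}`. -/
def regR (H : Hyper) (l : Fin L) (Θ : Gate L d K → ℝ) : ℝ :=
  H.ν * (H.β / H.F * (H.f₁ * norm2 Θ l.castSucc + H.fa + H.f₂ * norm2 Θ l.succ)
    + (1 - H.β) / H.P * (H.p₁ * norm2 Θ l.castSucc + 1 + H.p₂ * norm2 Θ l.succ))

/-- The states `(w_{1i}, w_{2i}, θ_{1i}, θ_B)`. -/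
abbrev UnitState (d : Fin (L + 1) → ℕ) (l : Fin L) : Type :=
  FanIn d l × FanOut d l × ℝ × ℝ

/-- States whose Bernoulli parameters lie in `[0, 1]`. -/
def admissible (d : Fin (L + 1) → ℕ) (l : Fin L) : Set (UnitState d l) :=
  {x | x.2.2.1 ∈ Icc (0 : ℝ) 1 ∧ x.2.2.2 ∈ Icc (0 : ℝ) 1}

/-- The parameters `Θ`, with `θ_{1i}` and `θ_B` of block `l` taken from the state. -/
def setTheta (Θ : Gate L d K → ℝ) (l : Fin L) (i : Fin (K l)) (x : UnitState d l) :
    Gate L d K → ℝ :=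
  Function.update (Function.update Θ (gate1 l i) x.2.2.1) (gateB l) x.2.2.2

/-- The right-hand side of the system without its projection terms, when the other weights and
the other Bernoulli parameters of the network are those in `W` and `Θ`. -/
def freeField (net : NetModel L d) (data : DataSet L d N) (H : Hyper) (l : Fin L) (i : Fin (K l))
    (W : Weights L d K) (Θ : Gate L d K → ℝ) (x : UnitState d l) : UnitState d l :=
  let w₁ := x.1
  let w₂ := x.2.1
  let θ₁ := x.2.2.1
  let θB := x.2.2.2
  let Wx := W.setUnit l i w₁ w₂
  let Θx := setTheta Θ l i x
  (-((θB * θ₁) • gradIn net data l i W Θx w₁ w₂) - H.lam • w₁,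
   -((θB * θ₁) • gradOut net data l i W Θx w₁ w₂) - H.lam • w₂,
   -(θB * (costUnit net data l i true Wx Θx - costUnit net data l i false Wx Θx + regR H l Θx)),
   -(costB net data l true Wx Θx - costB net data l false Wx Θx + norm1 Θx l * regR H l Θx)
      - H.ν * H.α)

/-- The projection term of a parameter with value `θ` and free velocity `-g`: it is
`-[g]₊` at `θ = 0`, `[g]₋` at `θ = 1` and `0` in between. -/
def projTerm (g θ : ℝ) : ℝ :=
  if θ = 0 then -(max g 0) else if θ = 1 then max (-g) 0 else 0

/-- The right-hand side of the projected system: the projection terms keep `θ_{1i}` and `θ_B`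
in `[0, 1]`. -/
def projField (net : NetModel L d) (data : DataSet L d N) (H : Hyper) (l : Fin L) (i : Fin (K l))
    (W : Weights L d K) (Θ : Gate L d K → ℝ) (x : UnitState d l) : UnitState d l :=
  let v := freeField net data H l i W Θ x
  (v.1, v.2.1, v.2.2.1 - projTerm (-v.2.2.1) x.2.2.1, v.2.2.2 - projTerm (-v.2.2.2) x.2.2.2)

end

/-!
### Time-varying systems on `[0, ∞)`
-/

section

variable {E : Type*} [NormedAddCommGroup E]

/-- Piecewise continuity on `[0, ∞)`: on each bounded interval finitely many discontinuities, with
one-sided limits everywhere. -/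
def PiecewiseContinuous (f : ℝ → E) : Prop :=
  ∀ T : ℝ, ∃ S : Finset ℝ, ∀ t ∈ Icc 0 T,
    (t ∉ S → ContinuousWithinAt f (Ici 0) t) ∧
    (∃ a, Tendsto f (𝓝[>] t) (𝓝 a)) ∧
    (0 < t → ∃ a, Tendsto f (𝓝[<] t) (𝓝 a))

/-- Local Lipschitz continuity on the set `A`, uniformly in time. -/
def LocLipschitzUniformly (f : ℝ → E → E) (A : Set E) : Prop :=
  ∀ x ∈ A, ∃ ε > 0, ∃ C : NNReal, ∀ t, 0 ≤ t → LipschitzOnWith C (f t) (A ∩ Metric.ball x ε)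

variable [NormedSpace ℝ E]

/-- A (Carathéodory) solution on `[t₀, ∞)`, with values in `A`, of `ẋ = f(t, x)`. -/
def IsSolution (f : ℝ → E → E) (A : Set E) (t₀ : ℝ) (x : ℝ → E) : Prop :=
  ∀ t, t₀ ≤ t → x t ∈ A ∧
    IntervalIntegrable (fun s => f s (x s)) volume t₀ t ∧
    x t = x t₀ + ∫ s in t₀..t, f s (x s)

/-- The trajectory `x` approaches the set `S`. -/
def Approaches (x : ℝ → E) (S : Set E) : Prop :=
  Tendsto (fun t => Metric.infDist (x t) S) atTop (𝓝 0)

/-- The region of attraction of `S` at the initial time `t₀`: the initial states from which a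
solution on `[t₀, ∞)` exists and from which every solution approaches `S`. -/
def regionOfAttraction (f : ℝ → E → E) (A : Set E) (t₀ : ℝ) (S : Set E) : Set E :=
  {x₀ | (∃ x, IsSolution f A t₀ x ∧ x t₀ = x₀) ∧
    ∀ x, IsSolution f A t₀ x → x t₀ = x₀ → Approaches x S}

end

section

variable {L : ℕ} {d : Fin (L + 1) → ℕ}

/-- `Λ_U = ½ (‖w_{1i}‖² + ‖w_{2i}‖² + θ_{1i}²)`. -/
def lyapU {l : Fin L} (x : UnitState d l) : ℝ :=
  1 / 2 * (‖x.1‖ ^ 2 + ‖x.2.1‖ ^ 2 + x.2.2.1 ^ 2)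

/-- The sublevel set `D_U`. -/
def setDU (d : Fin (L + 1) → ℕ) (l : Fin L) (Rm η κ : ℝ) : Set (UnitState d l) :=
  {x | x ∈ admissible d l ∧ lyapU x ≤ 1 / 2 * (Rm ^ 2 / (16 * (η + κ) ^ 2))}

/-- The set `E_U`. -/
def setEU (d : Fin (L + 1) → ℕ) (l : Fin L) (Rm η κ : ℝ) : Set (UnitState d l) :=
  {x | x ∈ setDU d l Rm η κ ∧ x.1 = 0 ∧ x.2.1 = 0 ∧ x.2.2.1 * x.2.2.2 = 0}

end

end

/-! Constants. For a fixed gate pattern the sample cost is C¹ in the weights, hence Lipschitz on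
balls. The Bernoulli parameters enter the expected cost only through averaging weights, so the same
Lipschitz constant serves for all of them (`exists_cost_bound`). It bounds the gradients, and
Cauchy–Schwarz gives η. For κ: with zero fan-out weights the gate of the unit is irrelevant, and
with a closed gate the fan-out weights are irrelevant. So the cost with the gate closed is the cost
with the gate open at `w₂ = 0` (`costUnit_true_zero_eq_costUnit_false`), and the difference is at
most a constant times ‖w₂‖.

Decrease. Differentiating Λ_U along the flow gives the weight decay term and -θ_B θ_{1i} times a
bracket of at least R - (η+κ)(‖w₁‖+‖w₂‖); the projection only helps. In D_U both norms are at most ρ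
= R_m/(4(η+κ)), so the bracket is at least R_m/2. The estimate is proved up to radius 3ρ/2, where
R_m/4 remains (`lyapDeriv_projField_le`); this margin allows a continuation argument showing that
trajectories cannot leave D_U. Integrating the dissipation and applying Barbalat's lemma makes ‖w₁‖,
‖w₂‖ and θ_{1i}θ_B tend to 0, and these control the distance to E_U.

Existence. The projected field is discontinuous in the state, so projected Euler schemes are run on
a box of coordinates. A subsequence converges, and the limit satisfies an integrated variational
inequality, which involves only the unprojected field and therefore survives the limit.
Differentiating it almost everywhere recovers the projected equation
(`exists_boxProjected_solution`). The box also truncates the weights at M, but the Lyapunov argument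
keeps the curve in D_U, strictly inside those faces. `IsTrajectoryBelow` states what this argument
needs of a curve, so that it applies both to given solutions and to the constructed curve before
that is known to be a solution. -/

/-! ### Averages over independent Bernoulli gates. -/

section Bernoulli

variable {L : ℕ} {d : Fin (L + 1) → ℕ} {K : Fin L → ℕ}

theorem bernoulliWeight_nonneg {Θ : Gate L d K → ℝ} (hΘ : InCube Θ) (Ξ : Gate L d K → Bool) :
    0 ≤ bernoulliWeight Θ Ξ := by
  refine Finset.prod_nonneg fun g _ => ?_
  have := hΘ g
  split_ifs
  · exact this.1
  · linarith [this.2]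

theorem sum_bernoulliWeight (Θ : Gate L d K → ℝ) :
    ∑ Ξ : Gate L d K → Bool, bernoulliWeight Θ Ξ = 1 := by
  have h := Finset.prod_univ_sum (fun _ : Gate L d K => (Finset.univ : Finset Bool))
    (fun g b => if b then Θ g else 1 - Θ g)
  rw [Fintype.piFinset_univ] at h
  unfold bernoulliWeight
  rw [← h]
  simp

theorem InCube.update {Θ : Gate L d K → ℝ} (hΘ : InCube Θ) (g : Gate L d K) {s : ℝ}
    (hs : s ∈ Icc (0 : ℝ) 1) : InCube (Function.update Θ g s) := by
  intro g'
  by_cases h : g' = g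
  · subst h; simpa using hs
  · simpa [h] using hΘ g'

theorem bit_mem_Icc (b : Bool) : bit b ∈ Icc (0 : ℝ) 1 := by
  cases b <;> simp [bit]

/-- An average over the Bernoulli variables of values bounded by `C` is bounded by `C`. -/
theorem abs_sum_bernoulliWeight_mul_le {Θ : Gate L d K → ℝ} (hΘ : InCube Θ)
    {φ : (Gate L d K → Bool) → ℝ} {C : ℝ} (hφ : ∀ Ξ, |φ Ξ| ≤ C) :
    |∑ Ξ, bernoulliWeight Θ Ξ * φ Ξ| ≤ C := by
  calc |∑ Ξ, bernoulliWeight Θ Ξ * φ Ξ| ≤ ∑ Ξ, |bernoulliWeight Θ Ξ * φ Ξ| :=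
        Finset.abs_sum_le_sum_abs _ _
    _ ≤ ∑ Ξ, bernoulliWeight Θ Ξ * C := by
        refine Finset.sum_le_sum fun Ξ _ => ?_
        rw [abs_mul, abs_of_nonneg (bernoulliWeight_nonneg hΘ Ξ)]
        exact mul_le_mul_of_nonneg_left (hφ Ξ) (bernoulliWeight_nonneg hΘ Ξ)
    _ = C := by rw [← Finset.sum_mul, sum_bernoulliWeight, one_mul]

/-- If `φ` does not depend on the gate `g`, its average does not depend on the parameter of `g`
being `0` or `1`. -/
theorem sum_bernoulliWeight_update_one_eq (Θ : Gate L d K → ℝ) (g : Gate L d K)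
    {φ : (Gate L d K → Bool) → ℝ} (hφ : ∀ Ξ b, φ (Function.update Ξ g b) = φ Ξ) :
    ∑ Ξ, bernoulliWeight (Function.update Θ g 1) Ξ * φ Ξ
      = ∑ Ξ, bernoulliWeight (Function.update Θ g 0) Ξ * φ Ξ := by
  have hinv : Function.Involutive
      (fun Ξ : Gate L d K → Bool => Function.update Ξ g (!(Ξ g))) := by
    intro Ξ; simp
  -- Flipping the gate `g` permutes the gate patterns and exchanges the weights for parameter 1 and
  -- parameter 0.
  rw [← Equiv.sum_comp (hinv.toPerm _)]
  refine Finset.sum_congr rfl fun Ξ _ => ?_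
  have : hinv.toPerm _ Ξ = Function.update Ξ g (!(Ξ g)) := rfl
  rw [this, hφ]
  congr 1
  refine Finset.prod_congr rfl fun g' _ => ?_
  by_cases h : g' = g
  · subst h; cases h' : Ξ g' <;> simp
  · simp [h]

theorem bernoulliWeight_update_zero {Θ : Gate L d K → ℝ} {g : Gate L d K}
    {Ξ : Gate L d K → Bool} (h : Ξ g = true) : bernoulliWeight (Function.update Θ g 0) Ξ = 0 :=
  Finset.prod_eq_zero (Finset.mem_univ g) (by simp [h])

end Bernoulli

/-! ### Smoothness of the network and the constants η, κ. -/

section Network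

variable {L N : ℕ} {d : Fin (L + 1) → ℕ} {K : Fin L → ℕ}

/-- The weights as a point of a normed space. -/
abbrev WeightSpace (L : ℕ) (d : Fin (L + 1) → ℕ) (K : Fin L → ℕ) : Type :=
  (∀ l : Fin L, Fin (K l) → Fin (d l.castSucc + 1) → ℝ) ×
  (∀ l : Fin L, Fin (d l.succ) → Fin (K l) → ℝ) ×
  (∀ l : Fin L, Fin (d l.succ) → Fin (d l.castSucc + 1) → ℝ)

/-- The weights with the entries `e`. -/
def Weights.ofSpace (e : WeightSpace L d K) : Weights L d K := ⟨e.1, e.2.1, e.2.2⟩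

/-- The entries of the weights `W`. -/
def Weights.toSpace (W : Weights L d K) : WeightSpace L d K := (W.W₁, W.W₂, W.W₃)

theorem Weights.BoundedBy.norm_toSpace_le {W : Weights L d K} {M : ℝ} (hM : 0 ≤ M)
    (h : W.BoundedBy M) : ‖W.toSpace‖ ≤ M := by
  refine norm_prod_le_iff.2 ⟨?_, norm_prod_le_iff.2 ⟨?_, ?_⟩⟩ <;>
  · simp only [pi_norm_le_iff_of_nonneg hM]
    intro l j k
    first | exact h.1 l j k | exact h.2.1 l j k | exact h.2.2 l j k

theorem contDiff_gatedFeatures (net : NetModel L d) (Ξ : Gate L d K → Bool) (l : Fin L)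
    (hh : ContDiff ℝ 1 (net.h l.castSucc)) {E : Type*} [NormedAddCommGroup E] [NormedSpace ℝ E]
    {z : E → Fin (d l.castSucc) → ℝ} (hz : ∀ k, ContDiff ℝ 1 fun e => z e k)
    (k : Fin (d l.castSucc + 1)) :
    ContDiff ℝ 1 fun e => gatedFeatures net Ξ l (z e) k := by
  induction k using Fin.lastCases with
  | last => simpa [gatedFeatures] using contDiff_const
  | cast k =>
    simp only [gatedFeatures, Fin.snoc_castSucc]
    exact contDiff_const.mul (hh.comp (hz k))

theorem features_succ (net : NetModel L d) (W : Weights L d K) (Ξ : Gate L d K → Bool)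
    (x : Fin (d 0) → ℝ) (l : Fin L) :
    features net W Ξ x l.succ = block net W Ξ l (features net W Ξ x l.castSucc) := by
  simp [features]

theorem contDiff_features (net : NetModel L d) (ha : ∀ l, ContDiff ℝ 1 (net.a l))
    (hh : ∀ l, ContDiff ℝ 1 (net.h l)) (Ξ : Gate L d K → Bool) (x : Fin (d 0) → ℝ)
    (l : Fin (L + 1)) :
    ∀ k, ContDiff ℝ 1 fun e : WeightSpace L d K =>
      features net (Weights.ofSpace e) Ξ x l k := by
  induction l using Fin.induction with
  | zero => intro k; simpa [features] using contDiff_const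
  | succ l ih =>
    intro k
    simp only [features_succ, block, Matrix.mulVec, dotProduct, Pi.add_apply, Pi.smul_apply,
      smul_eq_mul]
    have hg := contDiff_gatedFeatures net Ξ l (hh _) ih
    have h1 : ∀ j k, ContDiff ℝ 1 fun e : WeightSpace L d K => (Weights.ofSpace e).W₁ l j k :=
      fun j k => contDiff_pi.1 (contDiff_pi.1 (contDiff_pi.1 contDiff_fst l) j) k
    have h2 : ∀ j k, ContDiff ℝ 1 fun e : WeightSpace L d K => (Weights.ofSpace e).W₂ l j k :=
      fun j k => contDiff_pi.1 (contDiff_pi.1 (contDiff_pi.1 (contDiff_fst.comp contDiff_snd) l) j) k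
    have h3 : ∀ j k, ContDiff ℝ 1 fun e : WeightSpace L d K => (Weights.ofSpace e).W₃ l j k :=
      fun j k => contDiff_pi.1 (contDiff_pi.1 (contDiff_pi.1 (contDiff_snd.comp contDiff_snd) l) j) k
    refine (contDiff_const.mul (ContDiff.sum fun j _ => (h2 k j).mul
      (contDiff_const.mul ((ha l).comp (ContDiff.sum fun m _ => (h1 j m).mul (hg m)))))).add
      (ContDiff.sum fun m _ => (h3 k m).mul (hg m))

theorem contDiff_sampleCost (net : NetModel L d) (data : DataSet L d N)
    (ha : ∀ l, ContDiff ℝ 1 (net.a l)) (hh : ∀ l, ContDiff ℝ 1 (net.h l))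
    (hp : ∀ n, (∀ u, 0 < net.p u (data.y n)) ∧ ContDiff ℝ 1 (fun u => net.p u (data.y n)))
    (Ξ : Gate L d K → Bool) :
    ContDiff ℝ 1 fun e : WeightSpace L d K => sampleCost net data (Weights.ofSpace e) Ξ := by
  unfold sampleCost
  refine contDiff_const.mul (ContDiff.sum fun n _ => ContDiff.neg (ContDiff.log ?_ ?_))
  · refine (hp n).2.comp (contDiff_pi.2 fun k => ?_)
    exact (hh _).comp (contDiff_features net ha hh Ξ _ _ k)
  · exact fun e => ((hp n).1 _).ne'

/-- A `C¹` function on a finite-dimensional space is bounded and Lipschitz on balls. -/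
theorem exists_bound_and_lipschitzOnWith_closedBall {E : Type*} [NormedAddCommGroup E]
    [NormedSpace ℝ E] [ProperSpace E] {f : E → ℝ} (hf : ContDiff ℝ 1 f) (r : ℝ) :
    ∃ C : NNReal, LipschitzOnWith C f (Metric.closedBall 0 r) ∧
      ∀ e ∈ Metric.closedBall (0 : E) r, |f e| ≤ C := by
  obtain ⟨C₁, h₁⟩ := hf.contDiffOn.exists_lipschitzOnWith (s := Metric.closedBall (0 : E) r)
    (by decide) (convex_closedBall _ _) (isCompact_closedBall _ _)
  obtain ⟨C₂, h₂⟩ := (isCompact_closedBall (0 : E) r).exists_bound_of_continuousOn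
    hf.continuous.continuousOn
  refine ⟨max C₁ C₂.toNNReal, h₁.weaken (le_max_left _ _), fun e he => ?_⟩
  calc |f e| ≤ C₂ := h₂ e he
    _ ≤ C₂.toNNReal := Real.le_coe_toNNReal C₂
    _ ≤ _ := by exact_mod_cast le_max_right _ _

/-- On bounded sets of weights, the expected cost is bounded and Lipschitz in the weights,
uniformly over the Bernoulli parameters. -/
theorem exists_cost_bound (net : NetModel L d) (data : DataSet L d N)
    (ha : ∀ l, ContDiff ℝ 1 (net.a l)) (hh : ∀ l, ContDiff ℝ 1 (net.h l))
    (hp : ∀ n, (∀ u, 0 < net.p u (data.y n)) ∧ ContDiff ℝ 1 (fun u => net.p u (data.y n)))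
    (r : ℝ) :
    ∃ C : NNReal, ∀ Θ : Gate L d K → ℝ, InCube Θ → ∀ W : Weights L d K, ‖W.toSpace‖ ≤ r →
      |cost net data W Θ| ≤ C ∧ ∀ W' : Weights L d K, ‖W'.toSpace‖ ≤ r →
      |cost net data W Θ - cost net data W' Θ| ≤ C * dist W.toSpace W'.toSpace := by
  choose c hc hc' using fun Ξ : Gate L d K → Bool =>
    exists_bound_and_lipschitzOnWith_closedBall (contDiff_sampleCost net data ha hh hp Ξ) r
  have hle : ∀ Ξ, (c Ξ : ℝ) ≤ ((∑ Ξ, c Ξ : NNReal) : ℝ) := fun Ξ => by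
    exact_mod_cast Finset.single_le_sum (fun _ _ => zero_le) (Finset.mem_univ Ξ)
  refine ⟨∑ Ξ, c Ξ, fun Θ hΘ W hW => ⟨?_, fun W' hW' => ?_⟩⟩
  · exact abs_sum_bernoulliWeight_mul_le hΘ fun Ξ =>
      (hc' Ξ W.toSpace (mem_closedBall_zero_iff.2 hW)).trans (hle Ξ)
  · unfold cost
    rw [← Finset.sum_sub_distrib]
    simp_rw [← mul_sub]
    refine abs_sum_bernoulliWeight_mul_le hΘ fun Ξ => ?_
    exact ((hc Ξ).dist_le_mul W.toSpace (mem_closedBall_zero_iff.2 hW) W'.toSpace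
      (mem_closedBall_zero_iff.2 hW')).trans
        (mul_le_mul_of_nonneg_right (hle Ξ) dist_nonneg)

/-- Differentiability is not required: where it fails, the gradient has the default value 0. -/
theorem norm_gradient_le_of_lipschitz_near {F : Type*} [NormedAddCommGroup F]
    [InnerProductSpace ℝ F] [CompleteSpace F] {f : F → ℝ} {w : F} {C : NNReal}
    (h : ∀ u, dist u w ≤ 1 → ∀ v, dist v w ≤ 1 → |f u - f v| ≤ C * dist u v) :
    ‖gradient f w‖ ≤ C := by
  unfold gradient
  rw [LinearIsometryEquiv.norm_map]
  exact norm_fderiv_le_of_lipschitzOn ℝ (Metric.closedBall_mem_nhds w one_pos)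
    (LipschitzOnWith.of_dist_le_mul fun u hu v hv => h u hu v hv)

theorem features_congr {net : NetModel L d} {W W' : Weights L d K} {Ξ Ξ' : Gate L d K → Bool}
    (h : ∀ l z, block net W Ξ l z = block net W' Ξ' l z) (x : Fin (d 0) → ℝ) (l : Fin (L + 1)) :
    features net W Ξ x l = features net W' Ξ' x l := by
  induction l using Fin.induction with
  | zero => rfl
  | succ l ih => rw [features_succ, features_succ, ih, h]

theorem sampleCost_congr {net : NetModel L d} (data : DataSet L d N) {W W' : Weights L d K}
    {Ξ Ξ' : Gate L d K → Bool} (h : ∀ l z, block net W Ξ l z = block net W' Ξ' l z) :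
    sampleCost net data W Ξ = sampleCost net data W' Ξ' := by
  unfold sampleCost output
  simp only [features_congr h]

theorem setUnit_W₂_self (W : Weights L d K) (l : Fin L) (i : Fin (K l)) (w₁ : FanIn d l)
    (w₂ : FanOut d l) (k : Fin (d l.succ)) : (W.setUnit l i w₁ w₂).W₂ l k i = w₂ k := by
  simp [Weights.setUnit]

theorem setUnit_W₂_congr (W : Weights L d K) (l : Fin L) (i : Fin (K l)) (w₁ : FanIn d l)
    (w₂ w₂' : FanOut d l) {l' : Fin L} {j : Fin (K l')} (k : Fin (d l'.succ))
    (h : gate1 (d := d) l' j ≠ gate1 l i) :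
    (W.setUnit l i w₁ w₂).W₂ l' k j = (W.setUnit l i w₁ w₂').W₂ l' k j := by
  by_cases hl : l' = l
  · subst hl
    have : j ≠ i := fun hj => h (by rw [hj])
    simp [Weights.setUnit, this]
  · simp [Weights.setUnit, hl]

theorem gate1_eq_iff {l l' : Fin L} {i : Fin (K l)} {j : Fin (K l')} :
    (gate1 l' j : Gate L d K) = gate1 l i ↔ (⟨l', j⟩ : Σ l, Fin (K l)) = ⟨l, i⟩ := by
  simp [gate1]

theorem gatedFeatures_update_gate1 (net : NetModel L d) (Ξ : Gate L d K → Bool) (l : Fin L)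
    (i : Fin (K l)) (b : Bool) (l' : Fin L) (z : Fin (d l'.castSucc) → ℝ) :
    gatedFeatures net (Function.update Ξ (gate1 l i) b) l' z = gatedFeatures net Ξ l' z := by
  unfold gatedFeatures
  congr 1

/-- The gate of a unit with zero fan-out weights does not matter. -/
theorem sampleCost_setUnit_zero_update (net : NetModel L d) (data : DataSet L d N)
    (W : Weights L d K) (l : Fin L) (i : Fin (K l)) (w₁ : FanIn d l) (Ξ : Gate L d K → Bool)
    (b : Bool) :
    sampleCost net data (W.setUnit l i w₁ 0) (Function.update Ξ (gate1 l i) b)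
      = sampleCost net data (W.setUnit l i w₁ 0) Ξ := by
  refine sampleCost_congr data fun l' z => ?_
  unfold block
  simp only [gatedFeatures_update_gate1]
  have hB : Function.update Ξ (gate1 l i) b (gateB l') = Ξ (gateB l') :=
    Function.update_of_ne (by simp [gateB, gate1]) _ _
  rw [hB]
  congr 2
  ext k
  simp only [Matrix.mulVec, dotProduct]
  refine Finset.sum_congr rfl fun j _ => ?_
  by_cases h : (gate1 l' j : Gate L d K) = gate1 l i
  · obtain ⟨rfl, h⟩ := Sigma.mk.inj_iff.1 (gate1_eq_iff.1 h)
    obtain rfl := eq_of_heq h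
    simp [setUnit_W₂_self]
  · rw [Function.update_of_ne h]

/-- If the gate of a unit is closed, its fan-out weights do not matter. -/
theorem sampleCost_setUnit_of_gate_eq_false (net : NetModel L d) (data : DataSet L d N)
    (W : Weights L d K) (l : Fin L) (i : Fin (K l)) (w₁ : FanIn d l) (w₂ w₂' : FanOut d l)
    {Ξ : Gate L d K → Bool} (hΞ : Ξ (gate1 l i) = false) :
    sampleCost net data (W.setUnit l i w₁ w₂) Ξ
      = sampleCost net data (W.setUnit l i w₁ w₂') Ξ := by
  refine sampleCost_congr data fun l' z => ?_
  unfold block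
  congr 2
  ext k
  simp only [Matrix.mulVec, dotProduct]
  refine Finset.sum_congr rfl fun j _ => ?_
  by_cases h : (gate1 l' j : Gate L d K) = gate1 l i
  · obtain ⟨rfl, h⟩ := Sigma.mk.inj_iff.1 (gate1_eq_iff.1 h)
    obtain rfl := eq_of_heq h
    simp [hΞ, bit]
  · rw [setUnit_W₂_congr W l i w₁ w₂ w₂' k h]
    rfl

/-- This trades a change of gate for a change of weights, which the Lipschitz bound can measure. At
`w₂ = 0` the gate has no influence, so its parameter may be set to 0; then only patterns with the
gate closed have nonzero probability, and for them the fan-out weights are arbitrary. -/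
theorem costUnit_true_zero_eq_costUnit_false (net : NetModel L d) (data : DataSet L d N)
    (l : Fin L) (i : Fin (K l)) (W : Weights L d K) (Θ : Gate L d K → ℝ) (w₁ : FanIn d l)
    (w₂ : FanOut d l) :
    costUnit net data l i true (W.setUnit l i w₁ 0) Θ
      = costUnit net data l i false (W.setUnit l i w₁ w₂) Θ := by
  unfold costUnit cost
  simp only [bit, if_true, Bool.false_eq_true, if_false]
  rw [sum_bernoulliWeight_update_one_eq _ _
    fun Ξ b => sampleCost_setUnit_zero_update net data W l i w₁ Ξ b]
  refine Finset.sum_congr rfl fun Ξ _ => ?_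
  cases h : Ξ (gate1 l i) with
  | true => rw [bernoulliWeight_update_zero h, zero_mul, zero_mul]
  | false => rw [sampleCost_setUnit_of_gate_eq_false net data W l i w₁ 0 w₂ h]

theorem dist_toSpace_le {W W' : Weights L d K} {r : ℝ} (hr : 0 ≤ r)
    (h₁ : ∀ l j k, |W.W₁ l j k - W'.W₁ l j k| ≤ r) (h₂ : ∀ l j k, |W.W₂ l j k - W'.W₂ l j k| ≤ r)
    (h₃ : ∀ l j k, |W.W₃ l j k - W'.W₃ l j k| ≤ r) : dist W.toSpace W'.toSpace ≤ r := by
  refine max_le ?_ (max_le ?_ ?_) <;> simp only [dist_pi_le_iff hr]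
  · exact h₁
  · exact h₂
  · exact h₃

theorem dist_toSpace_setUnit_in_le (W : Weights L d K) (l : Fin L) (i : Fin (K l))
    (w w' : FanIn d l) (w₂ : FanOut d l) :
    dist (W.setUnit l i w w₂).toSpace (W.setUnit l i w' w₂).toSpace ≤ dist w w' := by
  refine dist_toSpace_le dist_nonneg (fun l' j k => ?_) (fun l' j k => ?_) (fun l' j k => ?_)
  · by_cases hl : l' = l
    · subst hl
      by_cases hj : j = i
      · subst hj
        simpa [Weights.setUnit, dist_eq_norm] using PiLp.norm_apply_le (w - w') k
      · simp [Weights.setUnit, Matrix.updateRow_apply, hj]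
    · simp [Weights.setUnit, hl]
  · simp [Weights.setUnit]
  · simp [Weights.setUnit]

theorem dist_toSpace_setUnit_out_le (W : Weights L d K) (l : Fin L) (i : Fin (K l))
    (w₁ : FanIn d l) (w w' : FanOut d l) :
    dist (W.setUnit l i w₁ w).toSpace (W.setUnit l i w₁ w').toSpace ≤ dist w w' := by
  refine dist_toSpace_le dist_nonneg (fun l' j k => ?_) (fun l' j k => ?_) (fun l' j k => ?_)
  · simp [Weights.setUnit]
  · by_cases hl : l' = l
    · subst hl
      by_cases hj : k = i
      · subst hj
        simpa [Weights.setUnit, dist_eq_norm] using PiLp.norm_apply_le (w - w') j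
      · simp [Weights.setUnit, hj]
    · simp [Weights.setUnit, hl]
  · simp [Weights.setUnit]

theorem setUnit_boundedBy {W : Weights L d K} {M : ℝ} (hW : W.BoundedBy M) (l : Fin L)
    (i : Fin (K l)) {w₁ : FanIn d l} {w₂ : FanOut d l} (h₁ : ∀ k, |w₁ k| ≤ M)
    (h₂ : ∀ k, |w₂ k| ≤ M) : (W.setUnit l i w₁ w₂).BoundedBy M := by
  refine ⟨fun l' j k => ?_, fun l' j k => ?_, hW.2.2⟩
  · by_cases hl : l' = l
    · subst hl
      by_cases hj : j = i
      · subst hj; simpa [Weights.setUnit] using h₁ k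
      · simpa [Weights.setUnit, Matrix.updateRow_apply, hj] using hW.1 l' j k
    · simpa [Weights.setUnit, hl] using hW.1 l' j k
  · by_cases hl : l' = l
    · subst hl
      by_cases hj : k = i
      · subst hj; simpa [Weights.setUnit] using h₂ j
      · simpa [Weights.setUnit, Matrix.updateCol_apply, hj] using hW.2.1 l' j k
    · simpa [Weights.setUnit, hl] using hW.2.1 l' j k

theorem Weights.BoundedBy.nonneg {W : Weights L d K} {M : ℝ} (hW : W.BoundedBy M) {l : Fin L}
    (i : Fin (K l)) : 0 ≤ M :=
  (abs_nonneg _).trans (hW.1 l i 0)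

/-- `W` itself need not be bounded in the entries of the unit, so the new weights are regarded as a
second replacement inside the bounded `W.setUnit l i w₁ w₂`. -/
theorem setUnit_zero_boundedBy {W : Weights L d K} {M : ℝ} {l : Fin L} {i : Fin (K l)}
    {w₁ : FanIn d l} {w₂ : FanOut d l} (h : (W.setUnit l i w₁ w₂).BoundedBy M) :
    (W.setUnit l i w₁ 0).BoundedBy M := by
  have hM : 0 ≤ M := h.nonneg i
  have h0 := setUnit_boundedBy h l i (w₁ := w₁) (w₂ := 0)
    (fun k => by simpa [Weights.setUnit] using h.1 l i k) (fun k => by simpa using hM)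
  convert! h0 using 1
  simp only [Weights.setUnit, Weights.mk.injEq, Function.update_self, Function.update_idem]
  refine ⟨?_, ?_, trivial⟩ <;> congr 1 <;> ext a b <;>
    simp [Matrix.updateRow_apply, Matrix.updateCol_apply] <;> grind

/-- Bounds for the expected costs and for the gradients of `C_{1i,1}^1`. -/
theorem exists_costUnit_bound (net : NetModel L d) (data : DataSet L d N)
    (ha : ∀ l, ContDiff ℝ 1 (net.a l)) (hh : ∀ l, ContDiff ℝ 1 (net.h l))
    (hp : ∀ n, (∀ u, 0 < net.p u (data.y n)) ∧ ContDiff ℝ 1 (fun u => net.p u (data.y n)))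
    (l : Fin L) (i : Fin (K l)) (M : ℝ) :
    ∃ C : NNReal, ∀ (W : Weights L d K) (Θ : Gate L d K → ℝ) (w₁ : FanIn d l) (w₂ : FanOut d l),
      (W.setUnit l i w₁ w₂).BoundedBy M → InCube Θ →
        ‖gradIn net data l i W Θ w₁ w₂‖ ≤ C ∧ ‖gradOut net data l i W Θ w₁ w₂‖ ≤ C ∧
        |costUnit net data l i true (W.setUnit l i w₁ w₂) Θ
          - costUnit net data l i false (W.setUnit l i w₁ w₂) Θ| ≤ C * ‖w₂‖ ∧
        (∀ Θ' : Gate L d K → ℝ, InCube Θ' → |cost net data (W.setUnit l i w₁ w₂) Θ'| ≤ C) := by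
  -- The extra 1 leaves room for a unit ball around the given weights, as the gradient needs the
  -- Lipschitz bound in a neighbourhood.
  obtain ⟨C, hC⟩ := exists_cost_bound (K := K) net data ha hh hp (M + 1)
  refine ⟨C, fun W Θ w₁ w₂ hW hΘ => ?_⟩
  have hM : 0 ≤ M := hW.nonneg i
  have hW₀ := hW.norm_toSpace_le hM
  have hΘ' : InCube (Function.update (Function.update Θ (gateB l) 1) (gate1 l i) (bit true)) :=
    (hΘ.update _ (by simp)).update _ (bit_mem_Icc _)
  have hball : ∀ {W' : Weights L d K},
      dist W'.toSpace (W.setUnit l i w₁ w₂).toSpace ≤ 1 → ‖W'.toSpace‖ ≤ M + 1 := fun {W'} h => by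
    have h1 := norm_le_norm_add_norm_sub' W'.toSpace (W.setUnit l i w₁ w₂).toSpace
    rw [dist_eq_norm] at h
    linarith
  refine ⟨norm_gradient_le_of_lipschitz_near fun u hu v hv => ?_,
    norm_gradient_le_of_lipschitz_near fun u hu v hv => ?_, ?_,
    fun Θ' hΘ' => (hC Θ' hΘ' _ (by linarith)).1⟩
  · exact ((hC _ hΘ' _ (hball ((dist_toSpace_setUnit_in_le W l i u w₁ w₂).trans hu))).2 _
      (hball ((dist_toSpace_setUnit_in_le W l i v w₁ w₂).trans hv))).trans
        (mul_le_mul_of_nonneg_left (dist_toSpace_setUnit_in_le W l i u v w₂) C.coe_nonneg)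
  · exact ((hC _ hΘ' _ (hball ((dist_toSpace_setUnit_out_le W l i w₁ u w₂).trans hu))).2 _
      (hball ((dist_toSpace_setUnit_out_le W l i w₁ v w₂).trans hv))).trans
        (mul_le_mul_of_nonneg_left (dist_toSpace_setUnit_out_le W l i w₁ u v) C.coe_nonneg)
  · rw [← costUnit_true_zero_eq_costUnit_false net data l i W Θ w₁ w₂]
    have h0 := (setUnit_zero_boundedBy hW).norm_toSpace_le hM
    have hd := dist_toSpace_setUnit_out_le W l i w₁ w₂ 0
    rw [dist_zero_right] at hd
    exact ((hC _ hΘ' _ (by linarith)).2 _ (by linarith)).trans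
      (mul_le_mul_of_nonneg_left hd C.coe_nonneg)

theorem exists_isBoundPair (net : NetModel L d) (data : DataSet L d N)
    (ha : ∀ l, ContDiff ℝ 1 (net.a l)) (hh : ∀ l, ContDiff ℝ 1 (net.h l))
    (hp : ∀ n, (∀ u, 0 < net.p u (data.y n)) ∧ ContDiff ℝ 1 (fun u => net.p u (data.y n)))
    (l : Fin L) (i : Fin (K l)) (M : ℝ) : ∃ η κ : ℝ, IsBoundPair net data l i M η κ := by
  obtain ⟨C, hC⟩ := exists_costUnit_bound net data ha hh hp l i M
  have hC0 : (0 : ℝ) ≤ C := C.coe_nonneg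
  -- `C` may vanish, whereas η and κ have to be positive.
  refine ⟨C + 1, C + 1, by positivity, by positivity, fun W Θ w₁ w₂ hW hΘ => ?_⟩
  obtain ⟨h₁, h₂, h₃, -⟩ := hC W Θ w₁ w₂ hW hΘ
  have n₁ := norm_nonneg w₁
  have n₂ := norm_nonneg w₂
  refine ⟨(abs_real_inner_le_norm _ _).trans ?_, (abs_real_inner_le_norm _ _).trans ?_,
    h₃.trans ?_⟩ <;> nlinarith

/-! ### Bounds for the regularization and for the right-hand side. -/

theorem abs_norm2_le {Θ : Gate L d K → ℝ} (hΘ : InCube Θ) (l : Fin (L + 1)) :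
    |norm2 Θ l| ≤ d l := by
  induction l using Fin.lastCases with
  | last => simp [norm2]
  | cast l =>
    simp only [norm2, Fin.lastCases_castSucc]
    rw [abs_of_nonneg (Finset.sum_nonneg fun _ _ => abs_nonneg _)]
    calc _ ≤ ∑ k : Fin (d l.castSucc), (1 : ℝ) := Finset.sum_le_sum fun k _ => by
          rw [abs_of_nonneg (hΘ _).1]; exact (hΘ _).2
      _ = _ := by simp

theorem abs_norm1_le {Θ : Gate L d K → ℝ} (hΘ : InCube Θ) (l : Fin L) :
    |norm1 Θ l| ≤ K l := by
  unfold norm1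
  rw [abs_of_nonneg (Finset.sum_nonneg fun _ _ => abs_nonneg _)]
  calc _ ≤ ∑ k : Fin (K l), (1 : ℝ) := Finset.sum_le_sum fun k _ => by
        rw [abs_of_nonneg (hΘ _).1]; exact (hΘ _).2
    _ = _ := by simp

theorem exists_regR_bound (H : Hyper) (l : Fin L) :
    ∃ C : ℝ, 0 ≤ C ∧ ∀ Θ : Gate L d K → ℝ, InCube Θ → |regR H l Θ| ≤ C := by
  refine ⟨|H.ν| * (|H.β / H.F| * (|H.f₁| * d l.castSucc + |H.fa| + |H.f₂| * d l.succ)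
    + |(1 - H.β) / H.P| * (|H.p₁| * d l.castSucc + |1| + |H.p₂| * d l.succ)), by positivity,
    fun Θ hΘ => ?_⟩
  have h₁ := abs_norm2_le hΘ l.castSucc
  have h₂ := abs_norm2_le hΘ l.succ
  have key : ∀ a b c : ℝ, |a * norm2 Θ l.castSucc + b + c * norm2 Θ l.succ|
      ≤ |a| * d l.castSucc + |b| + |c| * d l.succ := fun a b c => by
    refine (abs_add_three _ _ _).trans ?_
    rw [abs_mul, abs_mul]
    gcongr
  unfold regR
  rw [abs_mul]
  gcongr
  refine (abs_add_le _ _).trans ?_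
  rw [abs_mul, abs_mul]
  gcongr
  · exact key _ _ _
  · exact key _ _ _

theorem setTheta_inCube {Θ : Gate L d K → ℝ} (hΘ : InCube Θ) {l : Fin L} (i : Fin (K l))
    {x : UnitState d l} (hx : x ∈ admissible d l) : InCube (setTheta Θ l i x) :=
  (hΘ.update _ hx.1).update _ hx.2

theorem norm2_setTheta (Θ : Gate L d K → ℝ) (l : Fin L) (i : Fin (K l)) (x : UnitState d l)
    (l' : Fin (L + 1)) : norm2 (setTheta Θ l i x) l' = norm2 Θ l' := by
  induction l' using Fin.lastCases with
  | last => simp [norm2]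
  | cast l' =>
    simp only [norm2, Fin.lastCases_castSucc]
    refine Finset.sum_congr rfl fun k _ => ?_
    congr 1

/-- R depends only on the feature parameters θ₂, so the lower bound along the given `Θ` holds for
every state of the unit. -/
theorem regR_setTheta (H : Hyper) (Θ : Gate L d K → ℝ) (l : Fin L) (i : Fin (K l))
    (x : UnitState d l) : regR H l (setTheta Θ l i x) = regR H l Θ := by
  simp only [regR, norm2_setTheta]

theorem abs_projTerm_le (g θ : ℝ) : |projTerm g θ| ≤ |g| := by
  unfold projTerm
  split_ifs
  · rw [abs_neg, abs_of_nonneg (le_max_right _ _)]; exact max_le (le_abs_self g) (abs_nonneg g)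
  · rw [abs_of_nonneg (le_max_right _ _)]; exact max_le (neg_le_abs g) (abs_nonneg g)
  · simp

/-- The right-hand side without projection is bounded as long as the weights are. -/
theorem exists_freeField_bound (net : NetModel L d) (data : DataSet L d N)
    (ha : ∀ l, ContDiff ℝ 1 (net.a l)) (hh : ∀ l, ContDiff ℝ 1 (net.h l))
    (hp : ∀ n, (∀ u, 0 < net.p u (data.y n)) ∧ ContDiff ℝ 1 (fun u => net.p u (data.y n)))
    (H : Hyper) (l : Fin L) (i : Fin (K l)) (M r : ℝ) :
    ∃ B : ℝ, 0 ≤ B ∧ ∀ (W : Weights L d K) (Θ : Gate L d K → ℝ) (x : UnitState d l),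
      (W.setUnit l i x.1 x.2.1).BoundedBy M → InCube Θ → x ∈ admissible d l →
      ‖x.1‖ ≤ r → ‖x.2.1‖ ≤ r → ‖freeField net data H l i W Θ x‖ ≤ B := by
  obtain ⟨C, hC⟩ := exists_costUnit_bound net data ha hh hp l i M
  obtain ⟨D, hD0, hD⟩ := exists_regR_bound (d := d) (K := K) H l
  have hC0 : (0 : ℝ) ≤ C := C.coe_nonneg
  set B₁ : ℝ := C + |H.lam| * |r|
  set B₃ : ℝ := C + C + D
  set B₄ : ℝ := C + C + K l * D + |H.ν * H.α|
  have hB₁ : 0 ≤ B₁ := by positivity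
  have hB₃ : 0 ≤ B₃ := by positivity
  have hB₄ : 0 ≤ B₄ := by positivity
  refine ⟨B₁ + B₃ + B₄, by positivity, fun W Θ x hW hΘ hx hr₁ hr₂ => ?_⟩
  have hΘx := setTheta_inCube hΘ i hx
  obtain ⟨g₁, g₂, -, hc⟩ := hC W _ x.1 x.2.1 hW hΘx
  have hR := hD _ hΘx
  have hθ : |x.2.2.2 * x.2.2.1| ≤ 1 := by
    rw [abs_of_nonneg (mul_nonneg hx.2.1 hx.1.1)]
    exact mul_le_one₀ hx.2.2 hx.1.1 hx.1.2
  have hθB : |x.2.2.2| ≤ 1 := by rw [abs_of_nonneg hx.2.1]; exact hx.2.2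
  have hU : ∀ c, |costUnit net data l i c (W.setUnit l i x.1 x.2.1) (setTheta Θ l i x)| ≤ C :=
    fun c => hc _ ((hΘx.update _ (by simp)).update _ (bit_mem_Icc _))
  have hCB : ∀ b, |costB net data l b (W.setUnit l i x.1 x.2.1) (setTheta Θ l i x)| ≤ C :=
    fun c => hc _ (hΘx.update _ (bit_mem_Icc _))
  have hr₁' : ‖x.1‖ ≤ |r| := hr₁.trans (le_abs_self r)
  have hr₂' : ‖x.2.1‖ ≤ |r| := hr₂.trans (le_abs_self r)
  have w₁ : ‖(freeField net data H l i W Θ x).1‖ ≤ B₁ := by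
    refine (norm_sub_le _ _).trans ?_
    rw [norm_neg, norm_smul, norm_smul, Real.norm_eq_abs, Real.norm_eq_abs]
    refine add_le_add ((mul_le_mul hθ g₁ (norm_nonneg _) zero_le_one).trans (one_mul _).le) ?_
    gcongr
  have w₂ : ‖(freeField net data H l i W Θ x).2.1‖ ≤ B₁ := by
    refine (norm_sub_le _ _).trans ?_
    rw [norm_neg, norm_smul, norm_smul, Real.norm_eq_abs, Real.norm_eq_abs]
    refine add_le_add ((mul_le_mul hθ g₂ (norm_nonneg _) zero_le_one).trans (one_mul _).le) ?_
    gcongr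
  have t₁ : ‖(freeField net data H l i W Θ x).2.2.1‖ ≤ B₃ := by
    simp only [freeField, Real.norm_eq_abs, abs_neg, abs_mul]
    refine (mul_le_mul hθB ?_ (abs_nonneg _) zero_le_one).trans (one_mul _).le
    refine (abs_add_le _ _).trans (add_le_add ((abs_sub _ _).trans (add_le_add ?_ ?_)) hR)
    · exact hU true
    · exact hU false
  have t₂ : ‖(freeField net data H l i W Θ x).2.2.2‖ ≤ B₄ := by
    simp only [freeField, Real.norm_eq_abs]
    refine (abs_sub _ _).trans (add_le_add ?_ le_rfl)
    rw [abs_neg]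
    refine (abs_add_le _ _).trans (add_le_add ((abs_sub _ _).trans (add_le_add ?_ ?_)) ?_)
    · exact hCB true
    · exact hCB false
    · rw [abs_mul]
      exact mul_le_mul (abs_norm1_le hΘx l) hR (abs_nonneg _) (Nat.cast_nonneg _)
  simp only [norm_prod_le_iff]
  refine ⟨?_, ?_, ?_, ?_⟩ <;> linarith

theorem norm_projField_le {net : NetModel L d} {data : DataSet L d N} {H : Hyper} {l : Fin L}
    {i : Fin (K l)} {W : Weights L d K} {Θ : Gate L d K → ℝ} {x : UnitState d l} {B : ℝ}
    (h : ‖freeField net data H l i W Θ x‖ ≤ B) : ‖projField net data H l i W Θ x‖ ≤ 2 * B := by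
  have hB : 0 ≤ B := (norm_nonneg _).trans h
  simp only [norm_prod_le_iff] at h
  obtain ⟨h₁, h₂, h₃, h₄⟩ := h
  simp only [projField, norm_prod_le_iff, Real.norm_eq_abs] at *
  have h₃' := abs_projTerm_le (-(freeField net data H l i W Θ x).2.2.1) x.2.2.1
  have h₄' := abs_projTerm_le (-(freeField net data H l i W Θ x).2.2.2) x.2.2.2
  rw [abs_neg] at h₃' h₄'
  refine ⟨by linarith, by linarith, (abs_sub _ _).trans (by linarith),
    (abs_sub _ _).trans (by linarith)⟩

end Network

section BoxProjection

/-!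
### Projected differential equations on a box
-/

variable {ι : Type*}

/-- The projection onto the box `[lo, hi]`. -/
def clampBox (lo hi x : ι → ℝ) : ι → ℝ := fun i => max (lo i) (min (x i) (hi i))

theorem clampBox_mem {lo hi : ι → ℝ} (h : lo ≤ hi) (x : ι → ℝ) : clampBox lo hi x ∈ Icc lo hi :=
  ⟨fun _ => le_max_left _ _, fun i => max_le (h i) (min_le_right _ _)⟩

theorem clampBox_of_mem {lo hi x : ι → ℝ} (hx : x ∈ Icc lo hi) : clampBox lo hi x = x := by
  ext i
  simp [clampBox, hx.1 i, hx.2 i]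

theorem continuous_clampBox (lo hi : ι → ℝ) : Continuous (clampBox lo hi) := by
  unfold clampBox; fun_prop

theorem abs_max_min_sub_le (a b x y : ℝ) : |max a (min x b) - max a (min y b)| ≤ |x - y| := by
  rw [max_comm a, max_comm a]
  exact (abs_max_sub_max_le_abs _ _ _).trans (abs_inf_sub_inf_le_abs _ _ _)

/-- The projected Euler scheme with step `h`, for a right-hand side that is averaged in time. -/
noncomputable def projEuler (G : ℝ → (ι → ℝ) → ι → ℝ) (lo hi : ι → ℝ) (t₀ : ℝ) (x₀ : ι → ℝ) (h : ℝ) :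
    ℕ → ι → ℝ
  | 0 => x₀
  | k + 1 => clampBox lo hi fun i => projEuler G lo hi t₀ x₀ h k i
      + ∫ s in (t₀ + k * h)..(t₀ + (k + 1 : ℕ) * h), G s (projEuler G lo hi t₀ x₀ h k) i

/-- The projected Euler scheme as a step function of time. -/
noncomputable def projEulerStep (G : ℝ → (ι → ℝ) → ι → ℝ) (lo hi : ι → ℝ) (t₀ : ℝ) (x₀ : ι → ℝ) (h : ℝ)
    (t : ℝ) : ι → ℝ :=
  projEuler G lo hi t₀ x₀ h ⌊(t - t₀) / h⌋₊

variable {G : ℝ → (ι → ℝ) → ι → ℝ} {lo hi : ι → ℝ} {t₀ : ℝ} {x₀ : ι → ℝ} {h B : ℝ}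

theorem projEuler_mem (hlh : lo ≤ hi) (hx₀ : x₀ ∈ Icc lo hi) (k : ℕ) :
    projEuler G lo hi t₀ x₀ h k ∈ Icc lo hi := by
  cases k with
  | zero => exact hx₀
  | succ k => exact clampBox_mem hlh _

/-- Clamping is nonexpansive and fixes `z`. -/
theorem abs_projEuler_succ_sub_le (k : ℕ) (i : ι) {z : ℝ} (hz : z ∈ Icc (lo i) (hi i)) :
    |projEuler G lo hi t₀ x₀ h (k + 1) i - z| ≤ |projEuler G lo hi t₀ x₀ h k i
      + (∫ s in (t₀ + k * h)..(t₀ + (k + 1 : ℕ) * h), G s (projEuler G lo hi t₀ x₀ h k) i) - z|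
    := by
  have hz' : z = max (lo i) (min z (hi i)) := by simp [hz.1, hz.2]
  conv_lhs => rw [hz']
  exact abs_max_min_sub_le _ _ _ _

theorem abs_integral_step_le (hh : 0 ≤ h) (hB : ∀ t x i, |G t x i| ≤ B) (k : ℕ) (x : ι → ℝ)
    (i : ι) : |∫ s in (t₀ + k * h)..(t₀ + (k + 1 : ℕ) * h), G s x i| ≤ B * h := by
  refine (intervalIntegral.norm_integral_le_of_norm_le_const (f := fun s => G s x i) (C := B)
    fun s _ => hB s x i).trans ?_
  have : t₀ + (k + 1 : ℕ) * h - (t₀ + k * h) = h := by push_cast; ring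
  rw [this, abs_of_nonneg hh]

theorem lt_of_mem_Ioo_floor (hh : 0 < h) {k : ℕ} {s : ℝ}
    (hs : s ∈ Ioo (t₀ + k * h) (t₀ + (k + 1 : ℕ) * h)) : ⌊(s - t₀) / h⌋₊ = k := by
  have h1 : (k : ℝ) ≤ (s - t₀) / h := by rw [le_div_iff₀ hh]; linarith [hs.1]
  have h2 : (s - t₀) / h < k + 1 := by
    rw [div_lt_iff₀ hh]; have := hs.2; push_cast at this; linarith
  exact (Nat.floor_eq_iff ((Nat.cast_nonneg k).trans h1)).2 ⟨h1, h2⟩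

theorem abs_natFloor_sub_natFloor_le (a b : ℝ) : |(⌊a⌋₊ : ℝ) - ⌊b⌋₊| ≤ |a - b| + 1 := by
  wlog hab : b ≤ a generalizing a b
  · rw [abs_sub_comm, abs_sub_comm a]; exact this b a (le_of_not_ge hab)
  have hm : (⌊b⌋₊ : ℝ) ≤ ⌊a⌋₊ := by exact_mod_cast Nat.floor_mono hab
  rw [abs_of_nonneg (sub_nonneg.2 hm), abs_of_nonneg (sub_nonneg.2 hab)]
  have hb := Nat.lt_floor_add_one b
  rcases le_total a 0 with ha | ha
  · rw [Nat.floor_of_nonpos ha]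
    have : (0 : ℝ) ≤ ⌊b⌋₊ := Nat.cast_nonneg _
    push_cast; linarith
  · linarith [Nat.floor_le ha]

theorem measurable_projEulerStep : Measurable (projEulerStep G lo hi t₀ x₀ h) := by
  have h1 : Measurable fun t : ℝ => ⌊(t - t₀) / h⌋₊ :=
    Nat.measurable_floor.comp ((measurable_id.sub_const t₀).div_const h)
  exact (measurable_of_countable (projEuler G lo hi t₀ x₀ h)).comp h1

theorem abs_variation_le (hB : ∀ t x i, |G t x i| ≤ B) {x : ι → ℝ}
    (hx : x ∈ Icc lo hi) (s : ℝ) (i : ι) {z : ℝ} (hz : z ∈ Icc (lo i) (hi i)) :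
    |(x i - z) * G s x i| ≤ (hi i - lo i) * B := by
  rw [abs_mul]
  have : |x i - z| ≤ hi i - lo i := by
    rw [abs_le]; constructor <;> linarith [hx.1 i, hx.2 i, hz.1, hz.2]
  exact mul_le_mul this (hB _ _ _) (abs_nonneg _) ((abs_nonneg _).trans this)

variable [Fintype ι]

/-- One step moves each coordinate by at most `B * h`, and the step counts at two times differ by at
most `|s - t| / h + 1`; the additional 1 becomes the error `B * h`. -/
theorem dist_projEulerStep_le (hlh : lo ≤ hi) (hx₀ : x₀ ∈ Icc lo hi) (hh : 0 < h)
    (hB0 : 0 ≤ B) (hB : ∀ t x i, |G t x i| ≤ B) (s t : ℝ) :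
    dist (projEulerStep G lo hi t₀ x₀ h s) (projEulerStep G lo hi t₀ x₀ h t)
      ≤ B * (|s - t| + h) := by
  have hstep : ∀ k, dist (projEuler G lo hi t₀ x₀ h k) (projEuler G lo hi t₀ x₀ h (k + 1))
      ≤ B * h := fun k => by
    rw [dist_comm, dist_pi_le_iff (by positivity)]
    intro i
    have hk := projEuler_mem (G := G) (t₀ := t₀) (h := h) hlh hx₀ k
    rw [Real.dist_eq]
    refine (abs_projEuler_succ_sub_le k i ⟨hk.1 i, hk.2 i⟩).trans ?_
    rw [add_sub_cancel_left]
    exact abs_integral_step_le hh.le hB k _ i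
  have hgen : ∀ j k : ℕ, dist (projEuler G lo hi t₀ x₀ h j) (projEuler G lo hi t₀ x₀ h k)
      ≤ |(j : ℝ) - k| * (B * h) := fun j k => by
    wlog hjk : j ≤ k generalizing j k
    · rw [dist_comm, abs_sub_comm]; exact this k j (le_of_not_ge hjk)
    refine (dist_le_Ico_sum_of_dist_le (f := projEuler G lo hi t₀ x₀ h) hjk (d := fun _ => B * h) fun _ _ => hstep _).trans ?_
    have : (j : ℝ) ≤ k := by exact_mod_cast hjk
    rw [Finset.sum_const, Nat.card_Ico, nsmul_eq_mul, Nat.cast_sub hjk,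
      abs_sub_comm, abs_of_nonneg (sub_nonneg.2 this)]
  refine (hgen _ _).trans ?_
  calc _ ≤ (|(s - t₀) / h - (t - t₀) / h| + 1) * (B * h) := by
        gcongr; exact abs_natFloor_sub_natFloor_le _ _
    _ = B * (|s - t| + h) := by
        rw [← sub_div, abs_div, abs_of_pos hh, sub_sub_sub_cancel_right]
        field_simp

theorem measurable_comp_of_caratheodory (hG : ∀ x, Measurable fun t => G t x)
    (hGc : ∀ t, Continuous (G t)) {u : ℝ → ι → ℝ} (hu : Measurable u) :
    Measurable fun t => G t (u t) := by
  have := stronglyMeasurable_uncurry_of_continuous_of_stronglyMeasurable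
    (u := fun x t => G t x) hGc fun x => (hG x).stronglyMeasurable
  exact this.measurable.comp (hu.prodMk measurable_id)

theorem measurable_variation (hG : ∀ x, Measurable fun t => G t x)
    (hGc : ∀ t, Continuous (G t)) {u : ℝ → ι → ℝ} (hu : Measurable u) (i : ι) (z : ℝ) :
    Measurable fun s => (u s i - z) * G s (u s) i :=
  (((measurable_pi_apply i).comp hu).sub_const z).mul
    ((measurable_pi_apply i).comp (measurable_comp_of_caratheodory hG hGc hu))

theorem intervalIntegrable_variation (hG : ∀ x, Measurable fun t => G t x)
    (hGc : ∀ t, Continuous (G t)) (hB : ∀ t x i, |G t x i| ≤ B)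
    {u : ℝ → ι → ℝ} (hu : Measurable u) (hu' : ∀ t, u t ∈ Icc lo hi) (i : ι) {z : ℝ}
    (hz : z ∈ Icc (lo i) (hi i)) (a b : ℝ) :
    IntervalIntegrable (fun s => (u s i - z) * G s (u s) i) volume a b :=
  (intervalIntegrable_const (c := (hi i - lo i) * B)).mono_fun
    (measurable_variation hG hGc hu i z).aestronglyMeasurable
    (Eventually.of_forall fun s => (abs_variation_le hB (hu' s) s i hz).trans (le_abs_self _))

/-- With `I` the increment of a step before clamping, nonexpansiveness gives ½(x' - z)² ≤ ½(x - z)²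
+ (x - z)I + ½I². The middle term is the integral over the step, and ½I² ≤ ½B²h² adds up to an error
of order h. -/
theorem projEulerStep_variation_grid (hlh : lo ≤ hi) (hx₀ : x₀ ∈ Icc lo hi) (hh : 0 < h)
    (hG : ∀ x, Measurable fun t => G t x) (hGc : ∀ t, Continuous (G t)) (hB : ∀ t x i, |G t x i| ≤ B) (i : ι) {z : ℝ} (hz : z ∈ Icc (lo i) (hi i)) {j k : ℕ}
    (hjk : j ≤ k) :
    1 / 2 * (projEuler G lo hi t₀ x₀ h k i - z) ^ 2 - 1 / 2 * (projEuler G lo hi t₀ x₀ h j i - z) ^ 2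
      ≤ (∫ s in (t₀ + j * h)..(t₀ + k * h), (projEulerStep G lo hi t₀ x₀ h s i - z)
          * G s (projEulerStep G lo hi t₀ x₀ h s) i) + 1 / 2 * B ^ 2 * h * ((k - j) * h) := by
  have hint := fun a b => intervalIntegrable_variation hG hGc hB
    (measurable_projEulerStep (G := G) (lo := lo) (hi := hi) (t₀ := t₀) (x₀ := x₀) (h := h))
    (fun t => projEuler_mem hlh hx₀ _) i hz a b
  induction k, hjk using Nat.le_induction with
  | base => simp
  | succ k hjk ih =>
    have hle : t₀ + k * h ≤ t₀ + (k + 1 : ℕ) * h := by push_cast; nlinarith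
    set X := projEuler G lo hi t₀ x₀ h k with hX
    set I := ∫ s in (t₀ + k * h)..(t₀ + (k + 1 : ℕ) * h), G s X i with hI
    have h1 : ∫ s in (t₀ + k * h)..(t₀ + (k + 1 : ℕ) * h),
        (projEulerStep G lo hi t₀ x₀ h s i - z) * G s (projEulerStep G lo hi t₀ x₀ h s) i
        = (X i - z) * I := by
      rw [hI, ← intervalIntegral.integral_const_mul,
        intervalIntegral.integral_of_le hle, intervalIntegral.integral_of_le hle,
        integral_Ioc_eq_integral_Ioo, integral_Ioc_eq_integral_Ioo]
      refine setIntegral_congr_fun measurableSet_Ioo fun s hs => ?_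
      simp only [projEulerStep, lt_of_mem_Ioo_floor hh hs, hX]
    have h2 := abs_projEuler_succ_sub_le (G := G) (t₀ := t₀) (x₀ := x₀) (h := h) k i hz
    rw [← hX, ← hI] at h2
    have h3 : |I| ≤ B * h := abs_integral_step_le hh.le hB k X i
    have h4 := sq_le_sq.2 h2
    have h5 : I ^ 2 ≤ (B * h) ^ 2 := sq_le_sq' (by linarith [neg_abs_le I]) (by linarith [le_abs_self I])
    rw [← intervalIntegral.integral_add_adjacent_intervals (hint _ (t₀ + k * h)) (hint _ _), h1]
    push_cast
    nlinarith

/-- Both times are rounded down to the grid. The two leftover integrals are at most `(hi i - lo i) *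
B * h` each, and the grid length is at most `t - s + h`. -/
theorem projEulerStep_variation (hlh : lo ≤ hi) (hx₀ : x₀ ∈ Icc lo hi) (hh : 0 < h)
    (hG : ∀ x, Measurable fun t => G t x) (hGc : ∀ t, Continuous (G t)) (hB0 : 0 ≤ B)
    (hB : ∀ t x i, |G t x i| ≤ B) (i : ι) {z : ℝ} (hz : z ∈ Icc (lo i) (hi i)) {s t : ℝ}
    (hs : t₀ ≤ s) (hst : s ≤ t) :
    1 / 2 * (projEulerStep G lo hi t₀ x₀ h t i - z) ^ 2
        - 1 / 2 * (projEulerStep G lo hi t₀ x₀ h s i - z) ^ 2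
      ≤ (∫ r in s..t, (projEulerStep G lo hi t₀ x₀ h r i - z)
          * G r (projEulerStep G lo hi t₀ x₀ h r) i)
        + h * (1 / 2 * B ^ 2 * (t - s + h) + 2 * ((hi i - lo i) * B)) := by
  have hint := fun a b => intervalIntegrable_variation hG hGc hB
    (measurable_projEulerStep (G := G) (lo := lo) (hi := hi) (t₀ := t₀) (x₀ := x₀) (h := h))
    (fun t => projEuler_mem hlh hx₀ _) i hz a b
  have hfl : ∀ r, t₀ ≤ r → t₀ + ⌊(r - t₀) / h⌋₊ * h ≤ r ∧ r ≤ t₀ + ⌊(r - t₀) / h⌋₊ * h + h := by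
    intro r hr
    have h1 := Nat.floor_le (div_nonneg (sub_nonneg.2 hr) hh.le)
    have h2 := (Nat.lt_floor_add_one ((r - t₀) / h)).le
    rw [le_div_iff₀ hh] at h1
    rw [div_le_iff₀ hh] at h2
    constructor <;> linarith
  have hsmall : ∀ r, t₀ ≤ r → |∫ q in (t₀ + ⌊(r - t₀) / h⌋₊ * h)..r,
      (projEulerStep G lo hi t₀ x₀ h q i - z) * G q (projEulerStep G lo hi t₀ x₀ h q) i|
      ≤ (hi i - lo i) * B * h := by
    intro r hr
    refine (intervalIntegral.norm_integral_le_of_norm_le_const (C := (hi i - lo i) * B)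
      (f := fun q => (projEulerStep G lo hi t₀ x₀ h q i - z)
        * G q (projEulerStep G lo hi t₀ x₀ h q) i)
      fun q _ => abs_variation_le hB (projEuler_mem hlh hx₀ _) q i hz).trans ?_
    have := hfl r hr
    rw [abs_of_nonneg (by linarith)]
    have hD : 0 ≤ (hi i - lo i) * B := mul_nonneg (by linarith [hlh i]) hB0
    gcongr
    linarith
  have hgrid := projEulerStep_variation_grid (t₀ := t₀) hlh hx₀ hh hG hGc hB i hz
    (Nat.floor_mono (div_le_div_of_nonneg_right (sub_le_sub_right hst t₀) hh.le))
  have e1 := intervalIntegral.integral_add_adjacent_intervals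
    (hint (t₀ + ⌊(s - t₀) / h⌋₊ * h) (t₀ + ⌊(t - t₀) / h⌋₊ * h)) (hint _ t)
  have e2 := intervalIntegral.integral_add_adjacent_intervals
    (hint (t₀ + ⌊(s - t₀) / h⌋₊ * h) s) (hint _ t)
  have b1 := abs_le.1 (hsmall s hs)
  have b2 := abs_le.1 (hsmall t (hs.trans hst))
  have f1 := hfl s hs
  have f2 := hfl t (hs.trans hst)
  have hBh : 0 ≤ 1 / 2 * B ^ 2 * h := by positivity
  have : 1 / 2 * B ^ 2 * h * ((⌊(t - t₀) / h⌋₊ - ⌊(s - t₀) / h⌋₊ : ℝ) * h)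
      ≤ 1 / 2 * B ^ 2 * h * (t - s + h) := by
    refine mul_le_mul_of_nonneg_left ?_ hBh
    linarith
  unfold projEulerStep at *
  nlinarith

/-- A bounded sequence of functions that is Lipschitz up to errors tending to zero has a pointwise
convergent subsequence. -/
theorem exists_subseq_tendsto_of_almost_lipschitz {E : Type*} [MetricSpace E] [CompleteSpace E]
    {S : Set E} (hS : IsCompact S) {u : ℕ → ℝ → E} (hu : ∀ n t, u n t ∈ S) {B : ℝ}
    (hB : 0 ≤ B) {ε : ℕ → ℝ} (hε : Tendsto ε atTop (𝓝 0))
    (hlip : ∀ n s t, dist (u n s) (u n t) ≤ B * (|s - t| + ε n)) :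
    ∃ φ : ℕ → ℕ, StrictMono φ ∧ ∃ x : ℝ → E, ∀ t, Tendsto (fun n => u (φ n) t) atTop (𝓝 (x t)) := by
  -- Tychonoff gives convergence at all rational times; the almost-Lipschitz bound carries it to
  -- real times.
  have hK : IsCompact (Set.pi univ fun _ : ℚ => S) := isCompact_univ_pi fun _ => hS
  obtain ⟨y, -, φ, hφ, hy⟩ := hK.tendsto_subseq (x := fun n (q : ℚ) => u n q)
    fun n q _ => hu n q
  rw [tendsto_pi_nhds] at hy
  refine ⟨φ, hφ, ?_⟩
  suffices h : ∀ t, CauchySeq fun n => u (φ n) t from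
    ⟨fun t => (cauchySeq_tendsto_of_complete (h t)).choose,
      fun t => (cauchySeq_tendsto_of_complete (h t)).choose_spec⟩
  intro t
  rw [Metric.cauchySeq_iff]
  intro δ hδ
  -- `B + 1` instead of `B` avoids dividing by zero.
  have hη : 0 < δ / (8 * (B + 1)) := by positivity
  obtain ⟨q, hq⟩ := exists_rat_near t hη
  have h1 : ∀ᶠ n in atTop, ε (φ n) < δ / (8 * (B + 1)) :=
    (hε.comp hφ.tendsto_atTop).eventually (gt_mem_nhds hη)
  obtain ⟨N₁, hN₁⟩ := eventually_atTop.1 h1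
  obtain ⟨N₂, hN₂⟩ := Metric.cauchySeq_iff.1 (hy q).cauchySeq (δ / 2) (by positivity)
  have hclose : ∀ n ≥ N₁, dist (u (φ n) t) (u (φ n) q) ≤ δ / 4 := fun n hn => by
    have hn' := hN₁ n hn
    calc dist (u (φ n) t) (u (φ n) q) ≤ B * (|t - q| + ε (φ n)) := hlip _ _ _
      _ ≤ B * (δ / (8 * (B + 1)) + δ / (8 * (B + 1))) := by gcongr
      _ ≤ (B + 1) * (δ / (8 * (B + 1)) + δ / (8 * (B + 1))) := by gcongr; linarith
      _ = δ / 4 := by field_simp; norm_num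
  refine ⟨max N₁ N₂, fun m hm n hn => ?_⟩
  have d1 := hclose m (le_of_max_le_left hm)
  have d2 := hclose n (le_of_max_le_left hn)
  have d3 := hN₂ m (le_of_max_le_right hm) n (le_of_max_le_right hn)
  have := dist_triangle4 (u (φ m) t) (u (φ m) q) (u (φ n) q) (u (φ n) t)
  rw [dist_comm (u (φ n) q)] at this
  simp only [Function.comp] at d3
  linarith

/-- The integrated variational inequality of a projected differential equation on a box has a
solution, provided that the right-hand side is bounded, continuous in the state and measurable in
time. -/
theorem exists_variational_solution (hlh : lo ≤ hi) (hx₀ : x₀ ∈ Icc lo hi)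
    (hG : ∀ x, Measurable fun t => G t x) (hGc : ∀ t, Continuous (G t)) (hB0 : 0 ≤ B)
    (hB : ∀ t x i, |G t x i| ≤ B) (t₀ : ℝ) :
    ∃ x : ℝ → ι → ℝ, x t₀ = x₀ ∧ (∀ t, x t ∈ Icc lo hi) ∧
      (∀ s t, dist (x s) (x t) ≤ B * |s - t|) ∧
      ∀ i, ∀ z ∈ Icc (lo i) (hi i), ∀ s t, t₀ ≤ s → s ≤ t →
        1 / 2 * (x t i - z) ^ 2 - 1 / 2 * (x s i - z) ^ 2
          ≤ ∫ r in s..t, (x r i - z) * G r (x r) i := by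
  set ε : ℕ → ℝ := fun n => 1 / ((n : ℝ) + 1) with hε
  have hεpos : ∀ n, 0 < ε n := fun n => by positivity
  have hε0 : Tendsto ε atTop (𝓝 0) := tendsto_one_div_add_atTop_nhds_zero_nat
  set u : ℕ → ℝ → ι → ℝ := fun n => projEulerStep G lo hi t₀ x₀ (ε n) with hu
  have humem : ∀ n t, u n t ∈ Icc lo hi := fun n t => projEuler_mem hlh hx₀ _
  have hlip : ∀ n s t, dist (u n s) (u n t) ≤ B * (|s - t| + ε n) := fun n s t =>
    dist_projEulerStep_le hlh hx₀ (hεpos n) hB0 hB s t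
  obtain ⟨φ, hφ, x, hx⟩ := exists_subseq_tendsto_of_almost_lipschitz
    (isCompact_Icc (a := lo) (b := hi)) humem hB0 hε0 hlip
  have hεφ := hε0.comp hφ.tendsto_atTop
  have hxm : Measurable x := measurable_of_tendsto_metrizable
    (fun n => measurable_projEulerStep) (tendsto_pi_nhds.2 hx)
  refine ⟨x, ?_, fun t => isClosed_Icc.mem_of_tendsto (hx t) (Eventually.of_forall fun n =>
    humem _ t), fun s t => ?_, fun i z hz s t hs hst => ?_⟩
  · refine tendsto_nhds_unique (hx t₀) ?_
    have : ∀ n, u (φ n) t₀ = x₀ := fun n => by simp [hu, projEulerStep, projEuler]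
    simp [this]
  · refine le_of_tendsto_of_tendsto' ((hx s).dist (hx t)) ?_ fun n => hlip (φ n) s t
    simpa using (hεφ.const_add |s - t|).const_mul B
  · have hxi : ∀ t, Tendsto (fun n => u (φ n) t i) atTop (𝓝 (x t i)) := fun t =>
      tendsto_pi_nhds.1 (hx t) i
    have hlim : Tendsto (fun n => ∫ r in s..t, (u (φ n) r i - z) * G r (u (φ n) r) i) atTop
        (𝓝 (∫ r in s..t, (x r i - z) * G r (x r) i)) := by
      refine intervalIntegral.tendsto_integral_filter_of_dominated_convergence
        (fun _ => (hi i - lo i) * B)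
        (Eventually.of_forall fun n =>
          (measurable_variation hG hGc measurable_projEulerStep i z).aestronglyMeasurable)
        (Eventually.of_forall fun n => Eventually.of_forall fun r _ =>
          abs_variation_le hB (humem _ r) r i hz) intervalIntegrable_const
        (Eventually.of_forall fun r _ => ((hxi r).sub_const z).mul ?_)
      exact tendsto_pi_nhds.1 (((hGc r).tendsto _).comp (hx r)) i
    have herr : Tendsto (fun n => ε (φ n) * (1 / 2 * B ^ 2 * (t - s + ε (φ n))
        + 2 * ((hi i - lo i) * B))) atTop (𝓝 0) := by
      simpa using hεφ.mul
        (((hεφ.const_add (t - s)).const_mul (1 / 2 * B ^ 2)).add_const (2 * ((hi i - lo i) * B)))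
    have hR := hlim.add herr
    rw [add_zero] at hR
    refine le_of_tendsto_of_tendsto' ((((hxi t).sub_const z).pow 2).const_mul (1 / 2) |>.sub
      ((((hxi s).sub_const z).pow 2).const_mul (1 / 2))) hR fun n => ?_
    exact projEulerStep_variation hlh hx₀ (hεpos _) hG hGc hB0 hB i hz hs hst

/-- Existence for projected differential equations on a box: if the right-hand side is bounded and
continuous on the box and measurable in time, there is a Lipschitz function with values in the box
whose derivative agrees almost everywhere with the projected right-hand side. -/
theorem exists_boxProjected_solution {F : ℝ → (ι → ℝ) → ι → ℝ} (hlh : lo ≤ hi)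
    (hx₀ : x₀ ∈ Icc lo hi) (hF : ∀ x ∈ Icc lo hi, Measurable fun t => F t x)
    (hFc : ∀ t, ContinuousOn (F t) (Icc lo hi)) (hB0 : 0 ≤ B)
    (hB : ∀ t, ∀ x ∈ Icc lo hi, ∀ i, |F t x i| ≤ B) (t₀ : ℝ) :
    ∃ x : ℝ → ι → ℝ, x t₀ = x₀ ∧ (∀ t, x t ∈ Icc lo hi) ∧ LipschitzWith B.toNNReal x ∧
      ∀ᵐ t, t₀ < t → ∃ v : ι → ℝ, HasDerivAt x v t ∧ ∀ i,
        (lo i < x t i → v i ≤ F t (x t) i) ∧ (x t i < hi i → F t (x t) i ≤ v i) ∧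
        (x t i = lo i → v i = 0) ∧ (x t i = hi i → v i = 0) := by
  have hcl := continuous_clampBox lo hi
  -- Composing with the clamp extends the right-hand side from the box to the whole space, keeping
  -- its bound and its continuity.
  set G : ℝ → (ι → ℝ) → ι → ℝ := fun t x => F t (clampBox lo hi x) with hGdef
  have hG : ∀ x, Measurable fun t => G t x := fun x => hF _ (clampBox_mem hlh x)
  have hGc : ∀ t, Continuous (G t) := fun t =>
    (hFc t).comp_continuous hcl (clampBox_mem hlh)
  have hGB : ∀ t x i, |G t x i| ≤ B := fun t x i => hB t _ (clampBox_mem hlh x) i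
  obtain ⟨x, hx0, hxm, hlip, hvar⟩ := exists_variational_solution hlh hx₀ hG hGc hB0 hGB t₀
  have hL : LipschitzWith B.toNNReal x := LipschitzWith.of_dist_le_mul fun s t => by
    rw [Real.coe_toNNReal B hB0]; exact hlip s t
  refine ⟨x, hx0, hxm, hL, ?_⟩
  have hGF : ∀ t, G t (x t) = F t (x t) := fun t => by rw [hGdef]; simp [clampBox_of_mem (hxm t)]
  -- The null set depends on `z`; only the two endpoints of each coordinate are used below, so
  -- finitely many null sets suffice.
  have hleb : ∀ i, ∀ z ∈ Icc (lo i) (hi i), ∀ᵐ t, t₀ < t →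
      HasDerivAt (fun t => ∫ r in t₀..t, (x r i - z) * G r (x r) i)
        ((x t i - z) * G t (x t) i) t := by
    intro i z hz
    have hloc : LocallyIntegrable (fun r => (x r i - z) * G r (x r) i) volume := by
      refine (locallyIntegrable_const ((hi i - lo i) * B)).mono
        (measurable_variation hG hGc hL.continuous.measurable i z).aestronglyMeasurable
        (Eventually.of_forall fun s =>
          (abs_variation_le hGB (hxm s) s i hz).trans (le_abs_self _))
    filter_upwards [LocallyIntegrable.ae_hasDerivAt_integral hloc] with t ht _ using ht t₀
  have hlo : ∀ i, lo i ∈ Icc (lo i) (hi i) := fun i => ⟨le_rfl, hlh i⟩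
  have hhi : ∀ i, hi i ∈ Icc (lo i) (hi i) := fun i => ⟨hlh i, le_rfl⟩
  filter_upwards [hL.ae_differentiableAt, ae_all_iff.2 fun i => hleb i _ (hlo i),
    ae_all_iff.2 fun i => hleb i _ (hhi i)] with t hd h1 h2 ht
  have hd' := hd.hasDerivAt
  refine ⟨deriv x t, hd', fun i => ?_⟩
  have hdi : HasDerivAt (fun s => x s i) (deriv x t i) t := hasDerivAt_pi.1 hd' i
  have key : ∀ z ∈ Icc (lo i) (hi i), HasDerivAt (fun t => ∫ r in t₀..t, (x r i - z) * G r (x r) i)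
        ((x t i - z) * G t (x t) i) t → (x t i - z) * deriv x t i ≤ (x t i - z) * F t (x t) i := by
    -- The variational inequality says that the integral minus ½(x - z)² is nondecreasing; its
    -- derivative is therefore nonnegative.
    intro z hz hz'
    have hm : MonotoneOn (fun t => (∫ r in t₀..t, (x r i - z) * G r (x r) i)
        - 1 / 2 * (x t i - z) ^ 2) (Ici t₀) := by
      intro a ha b hb hab
      have hint := fun a b => intervalIntegrable_variation hG hGc hGB hL.continuous.measurable
        hxm i hz a b
      have := hvar i z hz a b ha hab
      have := intervalIntegral.integral_add_adjacent_intervals (hint t₀ a) (hint a b)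
      simp only
      linarith
    have hder : HasDerivAt (fun t => (∫ r in t₀..t, (x r i - z) * G r (x r) i)
        - 1 / 2 * (x t i - z) ^ 2) _ t :=
      hz'.sub (((hdi.sub_const z).pow 2).const_mul (1 / 2))
    have h0 := hm.derivWithin_nonneg (x := t)
    rw [derivWithin_of_mem_nhds (Ici_mem_nhds ht), hder.deriv, hGF] at h0
    norm_num at h0
    linarith
  have klo := key _ (hlo i) (h1 i ht)
  have khi := key _ (hhi i) (h2 i ht)
  -- The endpoint `lo i` gives `v i ≤ F` off the lower face, `hi i` the converse off the upper one.
  -- On a face the coordinate is extremal in time, so its derivative vanishes.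
  refine ⟨fun h => ?_, fun h => ?_, fun h => ?_, fun h => ?_⟩
  · exact le_of_mul_le_mul_left klo (sub_pos.2 h)
  · nlinarith
  · refine IsLocalMin.hasDerivAt_eq_zero (Eventually.of_forall fun s => ?_) hdi
    rw [h]; exact (hxm s).1 i
  · refine IsLocalMax.hasDerivAt_eq_zero (Eventually.of_forall fun s => ?_) hdi
    rw [h]; exact (hxm s).2 i

end BoxProjection

/-! ### Barbalat's lemma. -/

section Barbalat

/-- Barbalat's lemma: a nonnegative, uniformly continuous function whose integrals are bounded by
the decrease of a nonnegative function tends to zero. -/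
theorem tendsto_zero_of_integral_le_sub {ψ G : ℝ → ℝ} {t₀ : ℝ} (hψ : ∀ t, t₀ ≤ t → 0 ≤ ψ t)
    (hu : UniformContinuousOn ψ (Ici t₀)) (hG : ∀ t, t₀ ≤ t → 0 ≤ G t)
    (h : ∀ a b, t₀ ≤ a → a ≤ b → ∫ s in a..b, ψ s ≤ G a - G b) :
    Tendsto ψ atTop (𝓝 0) := by
  have hanti : ∀ a b, t₀ ≤ a → a ≤ b → G b ≤ G a := fun a b ha hab => by
    have h0 : 0 ≤ ∫ s in a..b, ψ s :=
      intervalIntegral.integral_nonneg hab fun s hs => hψ s (ha.trans hs.1)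
    linarith [h a b ha hab]
  have hlim : Tendsto (fun t => G (max t t₀)) atTop (𝓝 (⨅ t, G (max t t₀))) :=
    tendsto_atTop_ciInf
      (fun a b hab => hanti _ _ (le_max_right _ _) (max_le_max_right _ hab))
      ⟨0, by rintro _ ⟨t, rfl⟩; exact hG _ (le_max_right _ _)⟩
  rw [Metric.tendsto_atTop]
  intro ε hε
  obtain ⟨δ, hδ, hδ'⟩ := Metric.uniformContinuousOn_iff.1 hu (ε / 2) (by positivity)
  have hdiff : Tendsto (fun t => G (max t t₀) - G (max (t + δ / 2) t₀)) atTop (𝓝 0) := by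
    simpa using hlim.sub (hlim.comp (tendsto_atTop_add_const_right _ (δ / 2) tendsto_id))
  obtain ⟨T, hT⟩ := eventually_atTop.1
    (hdiff.eventually (gt_mem_nhds (show 0 < δ / 2 * (ε / 2) by positivity)))
  refine ⟨max T t₀, fun t ht => ?_⟩
  have htT := (le_max_left _ _).trans ht
  have ht₀ : t₀ ≤ t := (le_max_right _ _).trans ht
  have h1 := hT t htT
  rw [max_eq_left ht₀, max_eq_left (by linarith)] at h1
  rw [Real.dist_eq, sub_zero, abs_of_nonneg (hψ t ht₀)]
  by_contra! hcon
  -- If ψ(t) ≥ ε, uniform continuity keeps ψ above ε/2 on an interval of length δ/2, forcing `G` to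
  -- drop there by δ/2 · ε/2, more than is left after time `T`.
  have hab : t ≤ t + δ / 2 := by linarith
  have h2 : ∫ _s in t..(t + δ / 2), ε / 2 ≤ ∫ s in t..(t + δ / 2), ψ s := by
    refine intervalIntegral.integral_mono_on hab intervalIntegrable_const ?_ fun s hs => ?_
    · refine (hu.continuousOn.mono ?_).intervalIntegrable
      rw [uIcc_of_le hab]
      exact fun s hs => ht₀.trans hs.1
    · have := hδ' s (ht₀.trans hs.1) t ht₀ (by
        rw [Real.dist_eq, abs_of_nonneg (by linarith [hs.1])]; linarith [hs.2])
      rw [Real.dist_eq, abs_lt] at this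
      linarith [this.1]
  rw [intervalIntegral.integral_const, smul_eq_mul] at h2
  have := h t (t + δ / 2) ht₀ hab
  linarith

end Barbalat

/-! ### The Lyapunov argument for abstract trajectories. -/

section Lyapunov

variable {L : ℕ} {d : Fin (L + 1) → ℕ} {l : Fin L}

theorem continuous_lyapU : Continuous (lyapU : UnitState d l → ℝ) := by
  unfold lyapU; fun_prop

theorem lyapU_nonneg (x : UnitState d l) : 0 ≤ lyapU x := by
  unfold lyapU; positivity

theorem norm_le_of_lyapU_le {x : UnitState d l} {r : ℝ} (hr : 0 ≤ r)
    (h : lyapU x ≤ 1 / 2 * r ^ 2) : ‖x.1‖ ≤ r ∧ ‖x.2.1‖ ≤ r := by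
  unfold lyapU at h
  constructor <;> refine abs_le_of_sq_le_sq' ?_ hr |>.2 <;>
    nlinarith [sq_nonneg ‖x.1‖, sq_nonneg ‖x.2.1‖, sq_nonneg x.2.2.1]

/-- The derivative of `lyapU` at `x` in the direction `v`. -/
noncomputable def lyapDeriv (x v : UnitState d l) : ℝ :=
  inner ℝ x.1 v.1 + inner ℝ x.2.1 v.2.1 + x.2.2.1 * v.2.2.1

theorem hasDerivAt_lyapU {x : ℝ → UnitState d l} {v : UnitState d l} {t : ℝ}
    (h : HasDerivAt x v t) : HasDerivAt (fun s => lyapU (x s)) (lyapDeriv (x t) v) t := by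
  have h1 : HasDerivAt (fun s => (x s).1) v.1 t := h.fst
  have h2 : HasDerivAt (fun s => (x s).2.1) v.2.1 t := h.snd.fst
  have h3 : HasDerivAt (fun s => (x s).2.2.1) v.2.2.1 t := h.snd.snd.fst
  have := ((h1.norm_sq.add h2.norm_sq).add (h3.pow 2)).const_mul (1 / 2 : ℝ)
  refine this.congr_deriv ?_
  unfold lyapDeriv
  push_cast
  ring

theorem absolutelyContinuousOnInterval_lyapU {x : ℝ → UnitState d l} {a b : ℝ} {C : NNReal}
    (h : LipschitzOnWith C x (uIcc a b)) :
    AbsolutelyContinuousOnInterval (fun s => lyapU (x s)) a b := by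
  have h1 : AbsolutelyContinuousOnInterval (fun s => ‖(x s).1‖) a b :=
    ((lipschitzWith_one_norm.comp LipschitzWith.prod_fst).comp_lipschitzOnWith
      h).absolutelyContinuousOnInterval
  have h2 : AbsolutelyContinuousOnInterval (fun s => ‖(x s).2.1‖) a b :=
    ((lipschitzWith_one_norm.comp
      (LipschitzWith.prod_fst.comp LipschitzWith.prod_snd)).comp_lipschitzOnWith
        h).absolutelyContinuousOnInterval
  have h3 : AbsolutelyContinuousOnInterval (fun s => (x s).2.2.1) a b :=
    ((LipschitzWith.prod_fst.comp
      (LipschitzWith.prod_snd.comp LipschitzWith.prod_snd)).comp_lipschitzOnWith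
        h).absolutelyContinuousOnInterval
  have := (((h1.mul h1).add (h2.mul h2)).add (h3.mul h3)).const_mul (1 / 2)
  convert! this using 2 with s
  simp only [lyapU, Pi.add_apply, Pi.mul_apply]
  ring

/-- Trajectories of `ẋ = f(t, x)` in the region where `lyapU` is below `c`: there `x` is
Lipschitz and solves the equation almost everywhere. -/
structure IsTrajectoryBelow (f : ℝ → UnitState d l → UnitState d l) (t₀ c : ℝ) (C : NNReal)
    (x : ℝ → UnitState d l) : Prop where
  continuousOn : ContinuousOn x (Ici t₀)
  lipschitzOnWith : ∀ a b, t₀ ≤ a → a ≤ b → (∀ s ∈ Icc a b, lyapU (x s) < c) →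
    LipschitzOnWith C x (Icc a b)
  hasDerivAt : ∀ᵐ t, t₀ < t → lyapU (x t) < c → HasDerivAt x (f t (x t)) t

variable {f : ℝ → UnitState d l → UnitState d l} {t₀ c c₀ : ℝ} {C : NNReal}
  {x : ℝ → UnitState d l} {φ : UnitState d l → ℝ}

/-- Λ_U is absolutely continuous along a Lipschitz curve, so its almost-everywhere derivative
integrates to its increment. -/
theorem IsTrajectoryBelow.integral_le (hx : IsTrajectoryBelow f t₀ c C x) (hφ : Continuous φ)
    (hle : ∀ t, t₀ ≤ t → lyapU (x t) < c → lyapDeriv (x t) (f t (x t)) ≤ -φ (x t))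
    {a b : ℝ} (ha : t₀ ≤ a) (hab : a ≤ b) (hc : ∀ s ∈ Icc a b, lyapU (x s) < c) :
    ∫ s in a..b, φ (x s) ≤ lyapU (x a) - lyapU (x b) := by
  have hac : AbsolutelyContinuousOnInterval (fun s => lyapU (x s)) a b :=
    absolutelyContinuousOnInterval_lyapU (C := C)
      (by rw [uIcc_of_le hab]; exact hx.lipschitzOnWith a b ha hab hc)
  have hcont : ContinuousOn (fun s => φ (x s)) (uIcc a b) := by
    rw [uIcc_of_le hab]
    exact hφ.comp_continuousOn (hx.continuousOn.mono fun s hs => ha.trans hs.1)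
  have h1 : ∫ s in a..b, deriv (fun s => lyapU (x s)) s ≤ ∫ s in a..b, -φ (x s) := by
    refine intervalIntegral.integral_mono_ae_restrict hab hac.intervalIntegrable_deriv
      hcont.neg.intervalIntegrable ?_
    have hne : ∀ᵐ t : ℝ, t ≠ t₀ := by simp [ae_iff, measure_singleton]
    filter_upwards [ae_restrict_mem measurableSet_Icc, ae_restrict_of_ae hx.hasDerivAt,
      ae_restrict_of_ae hne] with t ht h hne
    have ht₀ : t₀ ≤ t := ha.trans ht.1
    rw [(hasDerivAt_lyapU (h (lt_of_le_of_ne ht₀ hne.symm) (hc t ht))).deriv]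
    exact hle t ht₀ (hc t ht)
  rw [hac.integral_deriv_eq_sub, intervalIntegral.integral_neg] at h1
  linarith

/-- Continuation: the set of times with Λ_U ≤ c₀ is closed, and from each of its points Λ_U stays
below `c > c₀` a little longer, where the decrease estimate applies and returns Λ_U ≤ c₀. -/
theorem IsTrajectoryBelow.lyapU_le (hx : IsTrajectoryBelow f t₀ c C x) (hφ : Continuous φ)
    (hφ0 : ∀ t, t₀ ≤ t → 0 ≤ φ (x t))
    (hle : ∀ t, t₀ ≤ t → lyapU (x t) < c → lyapDeriv (x t) (f t (x t)) ≤ -φ (x t))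
    (h₀ : lyapU (x t₀) ≤ c₀) (hcc : c₀ < c) {t : ℝ} (ht : t₀ ≤ t) : lyapU (x t) ≤ c₀ := by
  have hcont : ContinuousOn (fun s => lyapU (x s)) (Ici t₀) :=
    continuous_lyapU.comp_continuousOn hx.continuousOn
  have hsub : Icc t₀ t ⊆ {s | lyapU (x s) ≤ c₀} := by
    refine IsClosed.Icc_subset_of_forall_exists_gt ?_ h₀ fun a ha b hb => ?_
    · have := (hcont.mono (Icc_subset_Ici_self : Icc t₀ t ⊆ _)).preimage_isClosed_of_isClosed
        isClosed_Icc (isClosed_Iic (a := c₀))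
      rwa [inter_comm] at this
    · have hat : t₀ ≤ a := ha.2.1
      have hev : ∀ᶠ s in 𝓝[≥] a, lyapU (x s) < c :=
        ((hcont a hat).mono (Ici_subset_Ici.2 hat)).eventually
          (gt_mem_nhds (lt_of_le_of_lt ha.1 hcc))
      obtain ⟨u, hu, hu'⟩ := mem_nhdsGE_iff_exists_Icc_subset.1 hev
      have hm : a < min u b := lt_min hu hb
      refine ⟨min u b, ?_, hm, min_le_right _ _⟩
      have := hx.integral_le hφ hle hat hm.le fun s hs => hu' ⟨hs.1, hs.2.trans (min_le_left _ _)⟩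
      have h0 : 0 ≤ ∫ s in a..(min u b), φ (x s) :=
        intervalIntegral.integral_nonneg hm.le fun s hs => hφ0 s (hat.trans hs.1)
      have := ha.1
      simp only [mem_ofPred_eq] at this ⊢
      linarith
  exact hsub ⟨ht, le_rfl⟩

theorem IsTrajectoryBelow.antitoneOn (hx : IsTrajectoryBelow f t₀ c C x) (hφ : Continuous φ)
    (hφ0 : ∀ t, t₀ ≤ t → 0 ≤ φ (x t))
    (hle : ∀ t, t₀ ≤ t → lyapU (x t) < c → lyapDeriv (x t) (f t (x t)) ≤ -φ (x t))
    (h₀ : lyapU (x t₀) < c) : AntitoneOn (fun t => lyapU (x t)) (Ici t₀) := by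
  intro a ha b hb hab
  have h := hx.integral_le hφ hle ha hab fun s hs =>
    (hx.lyapU_le hφ hφ0 hle le_rfl h₀ (ha.trans hs.1)).trans_lt h₀
  have h0 : 0 ≤ ∫ s in a..b, φ (x s) :=
    intervalIntegral.integral_nonneg hab fun s hs => hφ0 s (ha.trans hs.1)
  simp only
  linarith

/-- The curve is Lipschitz and φ is uniformly continuous on the compact set, so Barbalat's lemma
applies to φ along the curve. -/
theorem IsTrajectoryBelow.tendsto_zero (hx : IsTrajectoryBelow f t₀ c C x) (hφ : Continuous φ)
    (hφ0 : ∀ t, t₀ ≤ t → 0 ≤ φ (x t))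
    (hle : ∀ t, t₀ ≤ t → lyapU (x t) < c → lyapDeriv (x t) (f t (x t)) ≤ -φ (x t))
    (h₀ : lyapU (x t₀) < c) {S : Set (UnitState d l)} (hS : IsCompact S)
    (hxS : ∀ t, t₀ ≤ t → x t ∈ S) : Tendsto (fun t => φ (x t)) atTop (𝓝 0) := by
  have hc : ∀ t, t₀ ≤ t → lyapU (x t) < c := fun t ht =>
    (hx.lyapU_le hφ hφ0 hle le_rfl h₀ ht).trans_lt h₀
  have hlip : LipschitzOnWith C x (Ici t₀) := by
    intro s hs t ht
    exact hx.lipschitzOnWith t₀ (max s t) le_rfl (le_max_of_le_left hs)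
      (fun r hr => hc r hr.1) ⟨hs, le_max_left _ _⟩ ⟨ht, le_max_right _ _⟩
  exact tendsto_zero_of_integral_le_sub (ψ := fun t => φ (x t)) (G := fun t => lyapU (x t)) hφ0
    ((hS.uniformContinuousOn_of_continuous hφ.continuousOn).comp hlip.uniformContinuousOn hxS)
    (fun t _ => lyapU_nonneg _)
    fun a b ha hab => hx.integral_le hφ hle ha hab fun s hs => hc s (ha.trans hs.1)

/-- The distance to `E_U` is controlled by the unit weights and the product `θ_{1i} θ_B`. -/
theorem infDist_setEU_le {Rm η κ : ℝ} {x : UnitState d l} (hx : x ∈ setDU d l Rm η κ) :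
    Metric.infDist x (setEU d l Rm η κ)
      ≤ ‖x.1‖ + ‖x.2.1‖ + Real.sqrt (x.2.2.1 * x.2.2.2) := by
  obtain ⟨⟨h1, h2⟩, hΛ⟩ := hx
  unfold lyapU at hΛ
  have n1 := norm_nonneg x.1
  have n2 := norm_nonneg x.2.1
  -- The comparison point has zero weights and the smaller of the two parameters set to 0. That
  -- parameter is at most the square root of the product, and Λ_U does not grow.
  rcases le_total x.2.2.1 x.2.2.2 with h | h
  · have hy : ((0, 0, 0, x.2.2.2) : UnitState d l) ∈ setEU d l Rm η κ := by
      refine ⟨⟨⟨by simp, h2⟩, ?_⟩, rfl, rfl, by simp⟩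
      simp only [lyapU, norm_zero]
      nlinarith [sq_nonneg ‖x.1‖, sq_nonneg ‖x.2.1‖, sq_nonneg x.2.2.1]
    have hs : x.2.2.1 ≤ Real.sqrt (x.2.2.1 * x.2.2.2) :=
      Real.le_sqrt_of_sq_le (by nlinarith [h1.1])
    refine (Metric.infDist_le_dist_of_mem hy).trans ?_
    simp only [Prod.dist_eq, dist_zero_right, dist_self, Real.norm_eq_abs, abs_of_nonneg h1.1]
    refine max_le ?_ (max_le ?_ (max_le ?_ ?_)) <;> linarith [h1.1]
  · have hy : ((0, 0, x.2.2.1, 0) : UnitState d l) ∈ setEU d l Rm η κ := by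
      refine ⟨⟨⟨h1, by simp⟩, ?_⟩, rfl, rfl, by simp⟩
      simp only [lyapU, norm_zero]
      nlinarith [sq_nonneg ‖x.1‖, sq_nonneg ‖x.2.1‖, sq_nonneg x.2.2.1]
    have hs : x.2.2.2 ≤ Real.sqrt (x.2.2.1 * x.2.2.2) :=
      Real.le_sqrt_of_sq_le (by nlinarith [h2.1])
    refine (Metric.infDist_le_dist_of_mem hy).trans ?_
    simp only [Prod.dist_eq, dist_zero_right, dist_self, Real.norm_eq_abs, abs_of_nonneg h2.1]
    refine max_le ?_ (max_le ?_ (max_le ?_ ?_)) <;> linarith [h2.1]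

theorem isCompact_setDU (d : Fin (L + 1) → ℕ) (l : Fin L) (Rm η κ : ℝ) :
    IsCompact (setDU d l Rm η κ) := by
  set ρ := Rm / (4 * (η + κ)) with hρ
  refine ((isCompact_closedBall (0 : UnitState d l) (max |ρ| 1))).of_isClosed_subset ?_ ?_
  · refine IsClosed.inter (IsClosed.inter ?_ ?_) (isClosed_le continuous_lyapU continuous_const)
    · exact isClosed_Icc.preimage (by fun_prop : Continuous fun x : UnitState d l => x.2.2.1)
    · exact isClosed_Icc.preimage (by fun_prop : Continuous fun x : UnitState d l => x.2.2.2)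
  · rintro x ⟨⟨h1, h2⟩, hΛ⟩
    have hsq : Rm ^ 2 / (16 * (η + κ) ^ 2) = |ρ| ^ 2 := by
      rw [sq_abs, hρ, div_pow, mul_pow]; norm_num
    rw [hsq] at hΛ
    obtain ⟨n1, n2⟩ := norm_le_of_lyapU_le (abs_nonneg _) hΛ
    rw [mem_closedBall_zero_iff]
    simp only [norm_prod_le_iff, Real.norm_eq_abs, abs_of_nonneg h1.1, abs_of_nonneg h2.1]
    exact ⟨le_max_of_le_left n1, le_max_of_le_left n2, le_max_of_le_right h1.2,
      le_max_of_le_right h2.2⟩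

/-- The rate at which `lyapU` decreases. -/
noncomputable def dissipation (lam Rm : ℝ) (x : UnitState d l) : ℝ :=
  lam * (‖x.1‖ ^ 2 + ‖x.2.1‖ ^ 2) + Rm / 4 * (x.2.2.1 * x.2.2.2)

theorem continuous_dissipation (lam Rm : ℝ) :
    Continuous (dissipation lam Rm : UnitState d l → ℝ) := by
  unfold dissipation; fun_prop

theorem dissipation_nonneg {lam Rm : ℝ} (hlam : 0 ≤ lam) (hRm : 0 ≤ Rm) {x : UnitState d l}
    (hx : x ∈ admissible d l) : 0 ≤ dissipation lam Rm x := by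
  have := mul_nonneg hx.1.1 hx.2.1
  unfold dissipation; positivity

theorem approaches_setEU {lam Rm η κ : ℝ} (hlam : 0 < lam) (hRm : 0 < Rm)
    (hx : ∀ t, t₀ ≤ t → x t ∈ setDU d l Rm η κ)
    (h : Tendsto (fun t => dissipation lam Rm (x t)) atTop (𝓝 0)) :
    Approaches x (setEU d l Rm η κ) := by
  have hev : ∀ᶠ t in atTop, t₀ ≤ t := eventually_ge_atTop t₀
  have key : ∀ g : UnitState d l → ℝ, ∀ k : ℝ, 0 < k →
      (∀ y ∈ setDU d l Rm η κ, 0 ≤ g y ∧ k * g y ≤ dissipation lam Rm y) →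
      Tendsto (fun t => Real.sqrt (g (x t))) atTop (𝓝 0) := fun g k hk hg => by
    have : Tendsto (fun t => g (x t)) atTop (𝓝 0) := by
      refine squeeze_zero' (hev.mono fun t ht => (hg _ (hx t ht)).1)
        (hev.mono fun t ht => ?_) (by simpa using h.div_const k)
      rw [le_div_iff₀ hk, mul_comm]
      exact (hg _ (hx t ht)).2
    simpa using this.sqrt
  have k1 := key (fun y => ‖y.1‖ ^ 2) lam hlam fun y hy => by
    have := mul_nonneg hy.1.1.1 hy.1.2.1
    refine ⟨by positivity, ?_⟩
    have : 0 ≤ Rm / 4 * (y.2.2.1 * y.2.2.2) := by positivity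
    unfold dissipation
    nlinarith [mul_nonneg hlam.le (sq_nonneg ‖y.2.1‖)]
  have k2 := key (fun y => ‖y.2.1‖ ^ 2) lam hlam fun y hy => by
    have := mul_nonneg hy.1.1.1 hy.1.2.1
    refine ⟨by positivity, ?_⟩
    have : 0 ≤ Rm / 4 * (y.2.2.1 * y.2.2.2) := by positivity
    unfold dissipation
    nlinarith [mul_nonneg hlam.le (sq_nonneg ‖y.1‖)]
  have k3 := key (fun y => y.2.2.1 * y.2.2.2) (Rm / 4) (by positivity) fun y hy => by
    refine ⟨mul_nonneg hy.1.1.1 hy.1.2.1, ?_⟩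
    unfold dissipation
    have : 0 ≤ lam * (‖y.1‖ ^ 2 + ‖y.2.1‖ ^ 2) := by positivity
    linarith
  have hsum := (k1.add k2).add k3
  simp only [Real.sqrt_sq (norm_nonneg _), add_zero] at hsum
  exact squeeze_zero' (Eventually.of_forall fun t => Metric.infDist_nonneg)
    (hev.mono fun t ht => infDist_setEU_le (hx t ht)) hsum

end Lyapunov

/-! ### Decrease of Λ_U along the projected system. -/

section Decrease

variable {L N : ℕ} {d : Fin (L + 1) → ℕ} {K : Fin L → ℕ}

/-- At θ = 0 the factor θ removes the projection term; at θ = 1 that term is nonnegative and is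
subtracted. -/
theorem mul_sub_projTerm_le {θ v : ℝ} : θ * (v - projTerm (-v) θ) ≤ θ * v := by
  unfold projTerm
  split_ifs with h0 h1
  · simp [h0]
  · subst h1; have := le_max_right (- -v) 0; linarith
  · simp

/-- Along the projected system, `lyapU` decreases as long as the unit weights are small. -/
theorem lyapDeriv_projField_le {net : NetModel L d} {data : DataSet L d N} {l : Fin L}
    {i : Fin (K l)} {M η κ : ℝ} (hb : IsBoundPair net data l i M η κ) (H : Hyper)
    {W : Weights L d K} {Θ : Gate L d K → ℝ} {x : UnitState d l} {Rm : ℝ}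
    (hW : (W.setUnit l i x.1 x.2.1).BoundedBy M) (hΘ : InCube Θ) (hx : x ∈ admissible d l)
    (hR : Rm ≤ regR H l Θ) (hw : (η + κ) * (‖x.1‖ + ‖x.2.1‖) ≤ 3 / 4 * Rm) :
    lyapDeriv x (projField net data H l i W Θ x) ≤ -dissipation H.lam Rm x := by
  obtain ⟨b1, b2, b3⟩ := hb.2.2 W (setTheta Θ l i x) x.1 x.2.1 hW (setTheta_inCube hΘ i hx)
  have ha : 0 ≤ x.2.2.2 * x.2.2.1 := mul_nonneg hx.2.1 hx.1.1
  have e1 : inner ℝ x.1 (projField net data H l i W Θ x).1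
      = -(x.2.2.2 * x.2.2.1) * inner ℝ x.1 (gradIn net data l i W (setTheta Θ l i x) x.1 x.2.1)
        - H.lam * ‖x.1‖ ^ 2 := by
    simp only [projField, freeField, inner_sub_right, inner_neg_right, real_inner_smul_right,
      real_inner_self_eq_norm_sq]
    ring
  have e2 : inner ℝ x.2.1 (projField net data H l i W Θ x).2.1
      = -(x.2.2.2 * x.2.2.1) * inner ℝ x.2.1 (gradOut net data l i W (setTheta Θ l i x) x.1 x.2.1)
        - H.lam * ‖x.2.1‖ ^ 2 := by
    simp only [projField, freeField, inner_sub_right, inner_neg_right, real_inner_smul_right,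
      real_inner_self_eq_norm_sq]
    ring
  have e3 : x.2.2.1 * (projField net data H l i W Θ x).2.2.1
      ≤ x.2.2.1 * (freeField net data H l i W Θ x).2.2.1 := mul_sub_projTerm_le
  have e4 : (freeField net data H l i W Θ x).2.2.1
      = -(x.2.2.2 * (costUnit net data l i true (W.setUnit l i x.1 x.2.1) (setTheta Θ l i x)
        - costUnit net data l i false (W.setUnit l i x.1 x.2.1) (setTheta Θ l i x)
        + regR H l (setTheta Θ l i x))) := rfl
  rw [e4, regR_setTheta] at e3
  unfold lyapDeriv dissipation
  rw [e1, e2]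
  generalize inner ℝ x.1 (gradIn net data l i W (setTheta Θ l i x) x.1 x.2.1) = p at *
  generalize inner ℝ x.2.1 (gradOut net data l i W (setTheta Θ l i x) x.1 x.2.1) = q at *
  generalize costUnit net data l i true (W.setUnit l i x.1 x.2.1) (setTheta Θ l i x)
    - costUnit net data l i false (W.setUnit l i x.1 x.2.1) (setTheta Θ l i x) = Δ at *
  have c1 := neg_le_of_abs_le b1
  have c2 := neg_le_of_abs_le b2
  have c3 := neg_le_of_abs_le b3
  -- The three bounds add up to p + q + Δ ≥ -(η+κ)(‖w₁‖+‖w₂‖) ≥ -3R_m/4, so a quarter of R_m is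
  -- left.
  have : x.2.2.2 * x.2.2.1 * (Rm / 4) ≤ x.2.2.2 * x.2.2.1 * (p + q + Δ + regR H l Θ) :=
    mul_le_mul_of_nonneg_left (by linarith) ha
  linarith

end Decrease

/-! ### Regularity in time and in the state. -/

section PiecewiseContinuous

/-- The finite exceptional sets of the horizons 0, 1, 2, … have a countable union, and changing a
function on a countable set preserves measurability. The indicator removes negative times, about
which nothing is assumed. -/
theorem PiecewiseContinuous.measurable_indicator {E : Type*} [NormedAddCommGroup E]
    [MeasurableSpace E] [BorelSpace E] {f : ℝ → E} (hf : PiecewiseContinuous f) :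
    Measurable ((Ici (0 : ℝ)).indicator f) := by
  classical
  choose S hS using hf
  set D : Set ℝ := ⋃ n : ℕ, (S n : Set ℝ) with hD
  have hDc : D.Countable := countable_iUnion fun n => (S n).countable_toSet
  have hcont : ContinuousOn f (Ici 0 \ D) := by
    rintro t ⟨ht0, htD⟩
    obtain ⟨n, hn⟩ := exists_nat_ge t
    exact ((hS n t ⟨ht0, hn⟩).1 fun h => htD (mem_iUnion.2 ⟨n, h⟩)).mono sdiff_subset
  have hm : Measurable ((Ici (0 : ℝ) \ D).piecewise f fun _ => 0) :=
    hcont.measurable_piecewise continuousOn_const (measurableSet_Ici.diff hDc.measurableSet)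
  refine hm.measurable_of_countable_ne (hDc.mono fun t ht => ?_)
  by_contra htD
  refine ht ?_
  by_cases h0 : t ∈ Ici (0 : ℝ)
  · have h1 : t ∈ Ici (0 : ℝ) \ D := ⟨h0, htD⟩
    rw [piecewise_eq_of_mem _ _ _ h1, indicator_of_mem h0]
  · rw [piecewise_eq_of_notMem _ _ _ fun h => h0 h.1, indicator_of_notMem h0]

theorem LocLipschitzUniformly.continuousOn {E : Type*} [NormedAddCommGroup E] {f : ℝ → E → E}
    {A : Set E} (hf : LocLipschitzUniformly f A) {t : ℝ} (ht : 0 ≤ t) : ContinuousOn (f t) A := by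
  intro x hx
  obtain ⟨ε, hε, C, hC⟩ := hf x hx
  exact ((hC t ht).continuousOn x ⟨hx, Metric.mem_ball_self hε⟩).mono_of_mem_nhdsWithin
    (inter_mem_nhdsWithin A (Metric.ball_mem_nhds x hε))

end PiecewiseContinuous

/-! ### Lipschitz curves and Carathéodory solutions. -/

section Solutions

theorem LipschitzWith.intervalIntegrable_deriv_and_integral_deriv {ι : Type*} [Fintype ι]
    {C : NNReal} {y : ℝ → ι → ℝ} (hy : LipschitzWith C y) (a b : ℝ) :
    IntervalIntegrable (deriv y) volume a b ∧ ∫ s in a..b, deriv y s = y b - y a := by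
  have hint : IntervalIntegrable (deriv y) volume a b :=
    (intervalIntegrable_const (c := (C : ℝ))).mono_fun (measurable_deriv y).aestronglyMeasurable
      (Eventually.of_forall fun s => (norm_deriv_le_of_lipschitz hy).trans (le_abs_self _))
  refine ⟨hint, ?_⟩
  ext i
  have h1 := (ContinuousLinearMap.proj (R := ℝ) (φ := fun _ : ι => ℝ) i).intervalIntegral_comp_comm
    hint
  simp only [ContinuousLinearMap.proj_apply] at h1
  have hyi : LipschitzWith C fun s => y s i := LipschitzWith.of_dist_le_mul fun s t =>
    (dist_le_pi_dist (y s) (y t) i).trans (hy.dist_le_mul s t)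
  rw [← h1, Pi.sub_apply,
    ← (hyi.lipschitzOnWith (s := uIcc a b)).absolutelyContinuousOnInterval.integral_deriv_eq_sub]
  refine intervalIntegral.integral_congr_ae ?_
  filter_upwards [hy.ae_differentiableAt] with s hs _
  exact (hasDerivAt_pi.1 hs.hasDerivAt i).deriv.symm

variable {L : ℕ} {d : Fin (L + 1) → ℕ} {l : Fin L}
  {f : ℝ → UnitState d l → UnitState d l} {A : Set (UnitState d l)} {t₀ c : ℝ}
  {C : NNReal} {x : ℝ → UnitState d l}

theorem IsSolution.isTrajectoryBelow (hx : IsSolution f A t₀ x)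
    (hC : ∀ t, t₀ ≤ t → lyapU (x t) < c → ‖f t (x t)‖ ≤ C) : IsTrajectoryBelow f t₀ c C x where
  continuousOn := by
    intro t ht
    have ht' : t₀ ≤ t + 1 := le_trans ht (by linarith)
    have hprim := intervalIntegral.continuousOn_primitive_interval' (hx (t + 1) ht').2.1
      left_mem_uIcc
    have hcont : ContinuousOn x (Icc t₀ (t + 1)) := by
      rw [uIcc_of_le ht'] at hprim
      refine (hprim.const_add (x t₀)).congr fun s hs => (hx s hs.1).2.2
    refine (hcont t ⟨ht, by linarith⟩).mono_of_mem_nhdsWithin ?_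
    rw [← Ici_inter_Iic]
    exact inter_mem_nhdsWithin _ (Iic_mem_nhds (by linarith))
  lipschitzOnWith := by
    intro a b ha hab hc
    refine LipschitzOnWith.of_dist_le_mul fun s hs t ht => ?_
    wlog hst : s ≤ t generalizing s t
    · rw [dist_comm, dist_comm s]; exact this t ht s hs (le_of_not_ge hst)
    have hs₀ := ha.trans hs.1
    have ht₀ := ha.trans ht.1
    have hsub : x t - x s = ∫ r in s..t, f r (x r) := by
      rw [(hx t ht₀).2.2, (hx s hs₀).2.2, add_sub_add_left_eq_sub,
        intervalIntegral.integral_interval_sub_left (hx t ht₀).2.1 (hx s hs₀).2.1]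
    rw [dist_comm, dist_eq_norm, hsub, dist_comm, Real.dist_eq]
    refine intervalIntegral.norm_integral_le_of_norm_le_const fun r hr => ?_
    rw [uIoc_of_le hst] at hr
    have hr' : a ≤ r := hs.1.trans hr.1.le
    exact hC r (ha.trans hr') (hc r ⟨hr', hr.2.trans ht.2⟩)
  hasDerivAt := by
    -- Lebesgue differentiation on each of countably many bounded intervals that exhaust the
    -- half-line.
    have h : ∀ n : ℕ, ∀ᵐ t, t ∈ uIcc t₀ (t₀ + n) → ∀ c ∈ uIcc t₀ (t₀ + n),
        HasDerivAt (fun t => ∫ s in c..t, f s (x s)) (f t (x t)) t := fun n =>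
      (hx (t₀ + n) (by simp)).2.1.ae_hasDerivAt_integral
    filter_upwards [ae_all_iff.2 h] with t ht htt _
    obtain ⟨n, hn⟩ := exists_nat_ge (t - t₀)
    have hd := (ht n (by rw [uIcc_of_le (by simp)]; exact ⟨htt.le, by linarith⟩) t₀
      left_mem_uIcc).const_add (x t₀)
    refine hd.congr_of_eventuallyEq ?_
    filter_upwards [Ioi_mem_nhds htt] with s hs
    exact (hx s (le_of_lt hs)).2.2

end Solutions

/-! ### Coordinates that turn the constraints into a box. -/

section Coordinates

variable {L : ℕ} {d : Fin (L + 1) → ℕ} {l : Fin L}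

/-- The coordinates of a state; `Sum.inr (Sum.inr b)` is `θ_B` for `b = true` and `θ_{1i}` for
`b = false`. -/
abbrev StateIndex (d : Fin (L + 1) → ℕ) (l : Fin L) : Type :=
  Fin (d l.castSucc + 1) ⊕ Fin (d l.succ) ⊕ Bool

/-- The state with the coordinates `y`. -/
noncomputable def stateOfCoords (d : Fin (L + 1) → ℕ) (l : Fin L) :
    (StateIndex d l → ℝ) →L[ℝ] UnitState d l :=
  LinearMap.toContinuousLinearMap
    { toFun := fun y => (WithLp.toLp 2 fun k => y (Sum.inl k),
        WithLp.toLp 2 fun k => y (Sum.inr (Sum.inl k)), y (Sum.inr (Sum.inr false)),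
        y (Sum.inr (Sum.inr true)))
      map_add' := fun _ _ => rfl
      map_smul' := fun _ _ => rfl }

/-- The coordinates of the state `x`. -/
def coordsOfState (x : UnitState d l) : StateIndex d l → ℝ :=
  Sum.elim (fun k => x.1 k) (Sum.elim (fun k => x.2.1 k) fun b => if b then x.2.2.2 else x.2.2.1)

theorem stateOfCoords_coordsOfState (x : UnitState d l) :
    stateOfCoords d l (coordsOfState x) = x := rfl

theorem continuous_coordsOfState :
    Continuous (coordsOfState : UnitState d l → StateIndex d l → ℝ) := by
  refine continuous_pi fun j => ?_
  rcases j with k | k | b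
  · simp only [coordsOfState, Sum.elim_inl]; fun_prop
  · simp only [coordsOfState, Sum.elim_inl, Sum.elim_inr]; fun_prop
  · cases b <;> simp only [coordsOfState, Sum.elim_inr, if_true, Bool.false_eq_true, if_false] <;>
      fun_prop

theorem abs_coordsOfState_le (x : UnitState d l) (j : StateIndex d l) :
    |coordsOfState x j| ≤ ‖x‖ := by
  have h := (norm_prod_le_iff (x := x)).1 le_rfl
  simp only [norm_prod_le_iff] at h
  rcases j with k | k | b
  · exact (PiLp.norm_apply_le x.1 k).trans h.1
  · exact (PiLp.norm_apply_le x.2.1 k).trans h.2.1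
  · cases b
    · exact h.2.2.1
    · exact h.2.2.2

/-- The lower bounds of the box of coordinates of admissible states with weights bounded by
`M`. -/
def lowerBox (d : Fin (L + 1) → ℕ) (l : Fin L) (M : ℝ) : StateIndex d l → ℝ :=
  Sum.elim (fun _ => -M) (Sum.elim (fun _ => -M) fun _ => 0)

/-- The upper bounds of the box of coordinates of admissible states with weights bounded by
`M`. -/
def upperBox (d : Fin (L + 1) → ℕ) (l : Fin L) (M : ℝ) : StateIndex d l → ℝ :=
  Sum.elim (fun _ => M) (Sum.elim (fun _ => M) fun _ => 1)

theorem lowerBox_le_upperBox {M : ℝ} (hM : 0 ≤ M) : lowerBox d l M ≤ upperBox d l M := by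
  rintro (k | k | b) <;> simp [lowerBox, upperBox] <;> linarith

theorem mem_box_iff {M : ℝ} {y : StateIndex d l → ℝ} :
    y ∈ Icc (lowerBox d l M) (upperBox d l M) ↔
      (∀ k, |(stateOfCoords d l y).1 k| ≤ M) ∧ (∀ k, |(stateOfCoords d l y).2.1 k| ≤ M) ∧
        stateOfCoords d l y ∈ admissible d l := by
  simp only [abs_le]
  constructor
  · rintro ⟨h1, h2⟩
    exact ⟨fun k => ⟨h1 (Sum.inl k), h2 (Sum.inl k)⟩,
      fun k => ⟨h1 (Sum.inr (Sum.inl k)), h2 (Sum.inr (Sum.inl k))⟩,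
      ⟨h1 (Sum.inr (Sum.inr false)), h2 (Sum.inr (Sum.inr false))⟩,
      ⟨h1 (Sum.inr (Sum.inr true)), h2 (Sum.inr (Sum.inr true))⟩⟩
  · rintro ⟨h1, h2, h3, h4⟩
    constructor
    · rintro (k | k | b)
      · exact (h1 k).1
      · exact (h2 k).1
      · cases b
        · exact h3.1
        · exact h4.1
    · rintro (k | k | b)
      · exact (h1 k).2
      · exact (h2 k).2
      · cases b
        · exact h3.2
        · exact h4.2

theorem norm_lt_of_lyapU_lt {x : UnitState d l} {r : ℝ} (hr : 0 ≤ r)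
    (h : lyapU x < 1 / 2 * r ^ 2) : ‖x.1‖ < r ∧ ‖x.2.1‖ < r := by
  unfold lyapU at h
  constructor <;> refine lt_of_pow_lt_pow_left₀ 2 hr ?_ <;>
    nlinarith [sq_nonneg ‖x.1‖, sq_nonneg ‖x.2.1‖, sq_nonneg x.2.2.1]

/-- On a face v = 0, and the remaining inequality makes the free velocity `g` point outward or
vanish, so the projection term cancels it exactly. In the interior the two inequalities give v = g.
-/
theorem eq_sub_projTerm {θ v g : ℝ} (h0 : 0 ≤ θ) (h1 : θ ≤ 1) (hle : 0 < θ → v ≤ g)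
    (hge : θ < 1 → g ≤ v) (hv0 : θ = 0 → v = 0) (hv1 : θ = 1 → v = 0) :
    v = g - projTerm (-g) θ := by
  unfold projTerm
  split_ifs with e0 e1
  · have := hge (by rw [e0]; exact one_pos)
    rw [hv0 e0] at this ⊢
    rw [max_eq_left (by linarith)]; ring
  · have := hle (by rw [e1]; exact one_pos)
    rw [hv1 e1] at this ⊢
    rw [neg_neg, max_eq_left this]; ring
  · have a1 := hle (lt_of_le_of_ne h0 (Ne.symm e0))
    have a2 := hge (lt_of_le_of_ne h1 e1)
    linarith

end Coordinates

/-! ### Invariance, attraction and existence for the unit. -/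

section UnitDynamics

variable {L N : ℕ} {d : Fin (L + 1) → ℕ} {K : Fin L → ℕ} {net : NetModel L d}
  {data : DataSet L d N} {l : Fin L} {i : Fin (K l)} {M η κ : ℝ} {H : Hyper}
  {W : ℝ → Weights L d K} {Θ : ℝ → Gate L d K → ℝ} {Rm t₀ r : ℝ}

theorem setDU_bound_eq (Rm η κ : ℝ) :
    1 / 2 * (Rm ^ 2 / (16 * (η + κ) ^ 2)) = 1 / 2 * (Rm / (4 * (η + κ))) ^ 2 := by
  rw [div_pow, mul_pow]; norm_num

/-- A trajectory of the projected system that starts in `D_U` stays there, does not increase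
`lyapU` and approaches `E_U`. -/
theorem IsTrajectoryBelow.setDU_conclusion (hb : IsBoundPair net data l i M η κ)
    (hlam : 0 < H.lam) (hWΘ : ∀ t, 0 ≤ t → (W t).BoundedBy M ∧ InCube (Θ t)) (hRm : 0 < Rm)
    (hR : ∀ t, 0 ≤ t → Rm ≤ regR H l (Θ t)) (ht₀ : 0 ≤ t₀)
    (hr : Rm / (4 * (η + κ)) < r) (hr' : r ≤ 3 / 2 * (Rm / (4 * (η + κ)))) {C : NNReal}
    {x : ℝ → UnitState d l}
    (hx : IsTrajectoryBelow (fun t => projField net data H l i (W t) (Θ t)) t₀ (1 / 2 * r ^ 2) C x)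
    (hA : ∀ t, t₀ ≤ t → x t ∈ admissible d l) (hx₀ : x t₀ ∈ setDU d l Rm η κ)
    (hM : ∀ t, t₀ ≤ t → lyapU (x t) < 1 / 2 * r ^ 2 →
      ((W t).setUnit l i (x t).1 (x t).2.1).BoundedBy M) :
    (∀ t, t₀ ≤ t → x t ∈ setDU d l Rm η κ) ∧ AntitoneOn (fun t => lyapU (x t)) (Ici t₀) ∧
      Approaches x (setEU d l Rm η κ) := by
  have hηκ : 0 < η + κ := add_pos hb.1 hb.2.1
  have hρ : 0 < Rm / (4 * (η + κ)) := by positivity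
  have hle : ∀ t, t₀ ≤ t → lyapU (x t) < 1 / 2 * r ^ 2 →
      lyapDeriv (x t) (projField net data H l i (W t) (Θ t) (x t))
        ≤ -dissipation H.lam Rm (x t) := fun t ht hlt => by
    refine lyapDeriv_projField_le hb H (hM t ht hlt) (hWΘ t (ht₀.trans ht)).2 (hA t ht)
      (hR t (ht₀.trans ht)) ?_
    obtain ⟨n1, n2⟩ := norm_le_of_lyapU_le (hρ.trans hr).le hlt.le
    -- Each norm is at most r ≤ 3ρ/2 with ρ = R_m/(4(η+κ)); this yields the 3R_m/4 that the decrease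
    -- estimate tolerates.
    calc (η + κ) * (‖(x t).1‖ + ‖(x t).2.1‖)
        ≤ (η + κ) * (2 * (3 / 2 * (Rm / (4 * (η + κ))))) := by gcongr; linarith
      _ = 3 / 4 * Rm := by field_simp
  have hφ := continuous_dissipation (d := d) (l := l) H.lam Rm
  have hφ0 : ∀ t, t₀ ≤ t → 0 ≤ dissipation H.lam Rm (x t) := fun t ht =>
    dissipation_nonneg hlam.le hRm.le (hA t ht)
  have hcc : 1 / 2 * (Rm ^ 2 / (16 * (η + κ) ^ 2)) < 1 / 2 * r ^ 2 := by
    rw [setDU_bound_eq]; gcongr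
  have hD : ∀ t, t₀ ≤ t → x t ∈ setDU d l Rm η κ := fun t ht =>
    ⟨hA t ht, hx.lyapU_le hφ hφ0 hle hx₀.2 hcc ht⟩
  have h₀ := hx₀.2.trans_lt hcc
  exact ⟨hD, hx.antitoneOn hφ hφ0 hle h₀, approaches_setEU hlam hRm hD
    (hx.tendsto_zero hφ hφ0 hle h₀ (isCompact_setDU d l Rm η κ) hD)⟩

/-- A solution of the projected system that starts in `D_U` stays there, does not increase
`lyapU` and approaches `E_U`. -/
theorem IsSolution.setDU_conclusion
    (ha : ∀ l, ContDiff ℝ 1 (net.a l)) (hh : ∀ l, ContDiff ℝ 1 (net.h l))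
    (hp : ∀ n, (∀ u, 0 < net.p u (data.y n)) ∧ ContDiff ℝ 1 (fun u => net.p u (data.y n)))
    (hb : IsBoundPair net data l i M η κ)
    (hlam : 0 < H.lam) (hWΘ : ∀ t, 0 ≤ t → (W t).BoundedBy M ∧ InCube (Θ t)) (hRm : 0 < Rm)
    (hR : ∀ t, 0 ≤ t → Rm ≤ regR H l (Θ t)) (ht₀ : 0 ≤ t₀)
    (hr : Rm / (4 * (η + κ)) < r) (hr' : r ≤ 3 / 2 * (Rm / (4 * (η + κ))))
    {x : ℝ → UnitState d l}
    (hx : IsSolution (fun t => projField net data H l i (W t) (Θ t)) (admissible d l) t₀ x)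
    (hx₀ : x t₀ ∈ setDU d l Rm η κ)
    (hM : ∀ t, t₀ ≤ t → lyapU (x t) < 1 / 2 * r ^ 2 →
      ((W t).setUnit l i (x t).1 (x t).2.1).BoundedBy M) :
    (∀ t, t₀ ≤ t → x t ∈ setDU d l Rm η κ) ∧ AntitoneOn (fun t => lyapU (x t)) (Ici t₀) ∧
      Approaches x (setEU d l Rm η κ) := by
  have hηκ : 0 < η + κ := add_pos hb.1 hb.2.1
  have hρ : 0 < Rm / (4 * (η + κ)) := by positivity
  obtain ⟨B, hB0, hB⟩ := exists_freeField_bound net data ha hh hp H l i M r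
  have hA : ∀ t, t₀ ≤ t → x t ∈ admissible d l := fun t ht => (hx t ht).1
  refine IsTrajectoryBelow.setDU_conclusion hb hlam hWΘ hRm hR ht₀ hr hr'
    (C := (2 * B).toNNReal) (hx.isTrajectoryBelow fun t ht hlt => ?_) hA hx₀ hM
  obtain ⟨n1, n2⟩ := norm_le_of_lyapU_le (hρ.trans hr).le hlt.le
  rw [Real.coe_toNNReal _ (by positivity)]
  exact norm_projField_le (hB _ _ _ (hM t ht hlt) (hWΘ t (ht₀.trans ht)).2 (hA t ht) n1 n2)

/-- From each point of `D_U` there is a solution of the projected system, if the weights in `D_U`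
are bounded by `M`. -/
theorem exists_isSolution_of_mem_setDU
    (ha : ∀ l, ContDiff ℝ 1 (net.a l)) (hh : ∀ l, ContDiff ℝ 1 (net.h l))
    (hp : ∀ n, (∀ u, 0 < net.p u (data.y n)) ∧ ContDiff ℝ 1 (fun u => net.p u (data.y n)))
    (hb : IsBoundPair net data l i M η κ)
    (hlam : 0 < H.lam) (hWΘ : ∀ t, 0 ≤ t → (W t).BoundedBy M ∧ InCube (Θ t)) (hRm : 0 < Rm)
    (hR : ∀ t, 0 ≤ t → Rm ≤ regR H l (Θ t))
    (hpc : ∀ x ∈ admissible d l,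
      PiecewiseContinuous fun t => freeField net data H l i (W t) (Θ t) x)
    (hlip : LocLipschitzUniformly (fun t => freeField net data H l i (W t) (Θ t))
      (admissible d l)) (ht₀ : 0 ≤ t₀)
    (hρM : Rm / (4 * (η + κ)) < M) {x₀ : UnitState d l} (hx₀ : x₀ ∈ setDU d l Rm η κ) :
    ∃ x, IsSolution (fun t => projField net data H l i (W t) (Θ t)) (admissible d l) t₀ x ∧
      x t₀ = x₀ := by
  have hηκ : 0 < η + κ := add_pos hb.1 hb.2.1
  set ρ := Rm / (4 * (η + κ)) with hρdef
  have hρ : 0 < ρ := by positivity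
  have hM0 : 0 ≤ M := (hρ.trans hρM).le
  set S := stateOfCoords d l
  -- Only the free field enters, since the box supplies the projection; it is set to 0 at negative
  -- times.
  set F : ℝ → (StateIndex d l → ℝ) → StateIndex d l → ℝ := fun t y =>
    coordsOfState ((Ici (0 : ℝ)).indicator
      (fun t => freeField net data H l i (W t) (Θ t) (S y)) t) with hF
  obtain ⟨r₁, hr₁⟩ := (isCompact_Icc (a := lowerBox d l M)
    (b := upperBox d l M)).exists_bound_of_continuousOn S.continuous.continuousOn
  obtain ⟨B, hB0, hB⟩ := exists_freeField_bound net data ha hh hp H l i M r₁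
  have hFB : ∀ t, ∀ y ∈ Icc (lowerBox d l M) (upperBox d l M), ∀ j, |F t y j| ≤ B := by
    intro t y hy j
    refine (abs_coordsOfState_le _ _).trans ?_
    by_cases ht : t ∈ Ici (0 : ℝ)
    · rw [indicator_of_mem ht]
      obtain ⟨h1, h2, h3⟩ := mem_box_iff.1 hy
      exact hB _ _ _ (setUnit_boundedBy (hWΘ t ht).1 l i h1 h2) (hWΘ t ht).2 h3
        ((norm_fst_le _).trans (hr₁ y hy))
        ((norm_fst_le _).trans ((norm_snd_le _).trans (hr₁ y hy)))
    · rw [indicator_of_notMem ht, norm_zero]; exact hB0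
  have hx₀S : S (coordsOfState x₀) = x₀ := stateOfCoords_coordsOfState x₀
  have hΛ₀ := hx₀.2
  rw [setDU_bound_eq] at hΛ₀
  obtain ⟨n1, n2⟩ := norm_le_of_lyapU_le hρ.le hΛ₀
  have hmem₀ : coordsOfState x₀ ∈ Icc (lowerBox d l M) (upperBox d l M) := by
    refine mem_box_iff.2 ⟨fun k => ?_, fun k => ?_, hx₀.1⟩
    · exact ((PiLp.norm_apply_le x₀.1 k).trans n1).trans hρM.le
    · exact ((PiLp.norm_apply_le x₀.2.1 k).trans n2).trans hρM.le
  obtain ⟨y, hy₀, hym, hyL, hyd⟩ := exists_boxProjected_solution (F := F)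
    (lowerBox_le_upperBox hM0) hmem₀
    (fun y hy => continuous_coordsOfState.measurable.comp
      (hpc _ (mem_box_iff.1 hy).2.2).measurable_indicator)
    (fun t => by
      by_cases ht : t ∈ Ici (0 : ℝ)
      · simp only [hF, indicator_of_mem ht]
        exact continuous_coordsOfState.comp_continuousOn ((hlip.continuousOn ht).comp
          S.continuous.continuousOn fun y hy => (mem_box_iff.1 hy).2.2)
      · simp only [hF, indicator_of_notMem ht]
        exact continuousOn_const)
    hB0 hFB t₀
  -- Below level ½r² the weights lie strictly inside the faces at ±M, and the decrease estimate
  -- holds.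
  set r := min M (3 / 2 * ρ) with hrdef
  have hρr : ρ < r := lt_min hρM (by linarith)
  have hSL : LipschitzWith (‖S‖₊ * B.toNNReal) fun t => S (y t) := S.lipschitz.comp hyL
  have hderiv : ∀ᵐ t, t₀ < t → lyapU (S (y t)) < 1 / 2 * r ^ 2 →
      HasDerivAt y (deriv y t) t ∧
        S (deriv y t) = projField net data H l i (W t) (Θ t) (S (y t)) := by
    filter_upwards [hyd] with t ht htt hlt
    obtain ⟨v, hv, hvi⟩ := ht htt
    rw [hv.deriv]
    refine ⟨hv, ?_⟩
    have ht0 : t ∈ Ici (0 : ℝ) := ht₀.trans htt.le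
    obtain ⟨m1, m2⟩ := norm_lt_of_lyapU_lt (hρ.trans hρr).le hlt
    have hFt : F t (y t) = coordsOfState (freeField net data H l i (W t) (Θ t) (S (y t))) := by
      simp only [hF, indicator_of_mem ht0]
    rw [hFt] at hvi
    obtain ⟨-, -, a1, a2⟩ := mem_box_iff.1 (hym t)
    -- Off the faces both one-sided inequalities hold, so the weights follow the free field.
    have hw1 : ∀ k, v (Sum.inl k) = (freeField net data H l i (W t) (Θ t) (S (y t))).1 k :=
      fun k => by
      have := abs_lt.1 (((PiLp.norm_apply_le (S (y t)).1 k).trans_lt m1).trans_le (min_le_left _ _))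
      exact le_antisymm ((hvi (Sum.inl k)).1 this.1) ((hvi (Sum.inl k)).2.1 this.2)
    have hw2 : ∀ k, v (Sum.inr (Sum.inl k))
        = (freeField net data H l i (W t) (Θ t) (S (y t))).2.1 k := fun k => by
      have := abs_lt.1
        (((PiLp.norm_apply_le (S (y t)).2.1 k).trans_lt m2).trans_le (min_le_left _ _))
      exact le_antisymm ((hvi _).1 this.1) ((hvi _).2.1 this.2)
    have e1 : (S v).1 = (freeField net data H l i (W t) (Θ t) (S (y t))).1 := by
      ext k; exact hw1 k
    have e2 : (S v).2.1 = (freeField net data H l i (W t) (Θ t) (S (y t))).2.1 := by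
      ext k; exact hw2 k
    have e3 := hvi (Sum.inr (Sum.inr false))
    have e4 := hvi (Sum.inr (Sum.inr true))
    refine Prod.ext e1 (Prod.ext e2 (Prod.ext ?_ ?_))
    · exact eq_sub_projTerm a1.1 a1.2 e3.1 e3.2.1 e3.2.2.1 e3.2.2.2
    · exact eq_sub_projTerm a2.1 a2.2 e4.1 e4.2.1 e4.2.2.1 e4.2.2.2
  have hA : ∀ t, S (y t) ∈ admissible d l := fun t => (mem_box_iff.1 (hym t)).2.2
  have htraj : IsTrajectoryBelow (fun t => projField net data H l i (W t) (Θ t)) t₀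
      (1 / 2 * r ^ 2) (‖S‖₊ * B.toNNReal) fun t => S (y t) :=
    { continuousOn := hSL.continuous.continuousOn
      lipschitzOnWith := fun a b _ _ _ => hSL.lipschitzOnWith
      hasDerivAt := by
        filter_upwards [hderiv] with t ht htt hlt
        obtain ⟨h1, h2⟩ := ht htt hlt
        rw [← h2]
        exact S.hasFDerivAt.comp_hasDerivAt t h1 }
  -- The curve solves the equation only below level ½r²; the Lyapunov argument now shows that it
  -- never leaves D_U, so the equation holds at almost all later times.
  have hD := (htraj.setDU_conclusion hb hlam hWΘ hRm hR ht₀ hρr (min_le_right _ _)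
    (fun t _ => hA t) (by rw [hy₀, hx₀S]; exact hx₀) fun t ht _ =>
      setUnit_boundedBy (hWΘ t (ht₀.trans ht)).1 l i (mem_box_iff.1 (hym t)).1
        (mem_box_iff.1 (hym t)).2.1).1
  have hae : ∀ t, t₀ ≤ t → ∀ᵐ s, s ∈ uIoc t₀ t →
      S (deriv y s) = projField net data H l i (W s) (Θ s) (S (y s)) := fun t ht => by
    filter_upwards [hderiv] with s hs hst
    rw [uIoc_of_le ht] at hst
    refine (hs hst.1 ((hD s hst.1.le).2.trans_lt ?_)).2
    rw [setDU_bound_eq]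
    gcongr
  refine ⟨fun t => S (y t), fun t ht => ⟨hA t, ?_, ?_⟩, by simp only [hy₀, hx₀S]⟩
  · obtain ⟨hi1, -⟩ := hyL.intervalIntegrable_deriv_and_integral_deriv t₀ t
    refine IntervalIntegrable.congr_ae ?_ ((ae_restrict_iff' measurableSet_uIoc).2 (hae t ht))
    exact ⟨S.integrable_comp hi1.1, S.integrable_comp hi1.2⟩
  · obtain ⟨hi1, hi2⟩ := hyL.intervalIntegrable_deriv_and_integral_deriv t₀ t
    rw [← intervalIntegral.integral_congr_ae (hae t ht), S.intervalIntegral_comp_comm hi1, hi2,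
      map_sub]
    abel

end UnitDynamics

/-! ### The theorem. -/

theorem theorem3 {L N : ℕ} {d : Fin (L + 1) → ℕ} {K : Fin L → ℕ}
    (net : NetModel L d) (data : DataSet L d N)
    -- activation functions: continuously differentiable, bounded derivative, zero at zero
    (ha : ∀ l, ContDiff ℝ 1 (net.a l) ∧ (∃ c, ∀ s, |deriv (net.a l) s| ≤ c) ∧ net.a l 0 = 0)
    (hh : ∀ l, ContDiff ℝ 1 (net.h l) ∧ (∃ c, ∀ s, |deriv (net.h l) s| ≤ c) ∧ net.h l 0 = 0)
    -- the likelihood is positive and continuously differentiable in the network output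
    (hp : ∀ n, (∀ u, 0 < net.p u (data.y n)) ∧ ContDiff ℝ 1 (fun u => net.p u (data.y n)))
    (l : Fin L) (i : Fin (K l)) (M : ℝ) :
    -- the constants `η`, `κ` exist, and depend only on the model, the data and the bound `M`
    (∃ η κ : ℝ, IsBoundPair net data l i M η κ) ∧
    ∀ η κ : ℝ, IsBoundPair net data l i M η κ →
    ∀ H : Hyper, 0 < H.lam → 0 < H.ν → 0 ≤ H.α → H.β ∈ Icc (0 : ℝ) 1 → 0 < H.F → 0 < H.P →
    -- the other variables of the network, as functions of time
    ∀ (W : ℝ → Weights L d K) (Θ : ℝ → Gate L d K → ℝ),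
      (∀ t, 0 ≤ t → (W t).BoundedBy M ∧ InCube (Θ t)) →
    ∀ Rm : ℝ, 0 < Rm → (∀ t, 0 ≤ t → Rm ≤ regR H l (Θ t)) →
      (∀ x ∈ admissible d l,
        PiecewiseContinuous (fun t => freeField net data H l i (W t) (Θ t) x)) →
      LocLipschitzUniformly (fun t => freeField net data H l i (W t) (Θ t)) (admissible d l) →
    ∀ t₀ : ℝ, 0 ≤ t₀ →
      -- a solution starting in `D_U`, along which the weights of the unit are bounded by `M` too,
      -- stays in `D_U`, does not increase `Λ_U`, and approaches `E_U`
      (∀ x : ℝ → UnitState d l,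
        IsSolution (fun t => projField net data H l i (W t) (Θ t)) (admissible d l) t₀ x →
        x t₀ ∈ setDU d l Rm η κ →
        (∀ t, t₀ ≤ t → ((W t).setUnit l i (x t).1 (x t).2.1).BoundedBy M) →
        (∀ t, t₀ ≤ t → x t ∈ setDU d l Rm η κ) ∧
        AntitoneOn (fun t => lyapU (x t)) (Ici t₀) ∧
        Approaches x (setEU d l Rm η κ)) ∧
      -- if the radius of `D_U` is below `M`, then that bound need not be assumed, and
      -- `D_U` is contained in the region of attraction of `E_U`
      (Rm / (4 * (η + κ)) < M →
        (∀ x : ℝ → UnitState d l,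
          IsSolution (fun t => projField net data H l i (W t) (Θ t)) (admissible d l) t₀ x →
          x t₀ ∈ setDU d l Rm η κ →
          (∀ t, t₀ ≤ t → x t ∈ setDU d l Rm η κ) ∧
          AntitoneOn (fun t => lyapU (x t)) (Ici t₀)) ∧
        setDU d l Rm η κ ⊆
          regionOfAttraction (fun t => projField net data H l i (W t) (Θ t)) (admissible d l) t₀
            (setEU d l Rm η κ)) := by
  have ha' := fun l => (ha l).1
  have hh' := fun l => (hh l).1
  refine ⟨exists_isBoundPair net data ha' hh' hp l i M, ?_⟩
  intro η κ hb H hlam _ _ _ _ _ W Θ hWΘ Rm hRm hR hpc hlip t₀ ht₀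
  have hηκ : 0 < η + κ := add_pos hb.1 hb.2.1
  have hρ : 0 < Rm / (4 * (η + κ)) := by positivity
  refine ⟨fun x hx hx₀ hM => hx.setDU_conclusion ha' hh' hp hb hlam hWΘ hRm hR ht₀
    (r := 3 / 2 * (Rm / (4 * (η + κ)))) (by linarith) le_rfl hx₀ fun t ht _ => hM t ht,
    fun hρM => ?_⟩
  have hsol : ∀ x : ℝ → UnitState d l,
      IsSolution (fun t => projField net data H l i (W t) (Θ t)) (admissible d l) t₀ x →
      x t₀ ∈ setDU d l Rm η κ →
      (∀ t, t₀ ≤ t → x t ∈ setDU d l Rm η κ) ∧ AntitoneOn (fun t => lyapU (x t)) (Ici t₀) ∧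
        Approaches x (setEU d l Rm η κ) := fun x hx hx₀ =>
    hx.setDU_conclusion ha' hh' hp hb hlam hWΘ hRm hR ht₀
      -- Capping the radius by M makes the bound on the unit's weights a consequence of the level of
      -- Λ_U.
      (r := min M (3 / 2 * (Rm / (4 * (η + κ))))) (lt_min hρM (by linarith)) (min_le_right _ _)
      hx₀ fun t ht hlt => by
        obtain ⟨n1, n2⟩ := norm_lt_of_lyapU_lt (le_min (hρ.trans hρM).le (by linarith)) hlt
        exact setUnit_boundedBy (hWΘ t (ht₀.trans ht)).1 l i
          (fun k => (PiLp.norm_apply_le (x t).1 k).trans (n1.le.trans (min_le_left _ _)))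
          (fun k => (PiLp.norm_apply_le (x t).2.1 k).trans (n2.le.trans (min_le_left _ _)))
  refine ⟨fun x hx hx₀ => ⟨(hsol x hx hx₀).1, (hsol x hx hx₀).2.1⟩, fun x₀ hx₀ => ⟨?_, ?_⟩⟩
  · exact exists_isSolution_of_mem_setDU ha' hh' hp hb hlam hWΘ hRm hR hpc hlip ht₀ hρM hx₀
  · rintro x hx rfl
    exact (hsol x hx hx₀).2.2
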